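/- **Setting.** Fix $T>0$, a countable set $\Omega$ with its power set $2^\Omega$ as $\sigma$-algebra, a probability measure $\mathbb P$ on it, and a filtration $(\mathcal F_t)_{t\in[0,T]}$ satisfying the usual conditions; write $\mathbb E_t=\mathbb E[\,\cdot\,|\mathcal F_t]$. Let $$\mathcal L^2=\Big\{f:[0,T]\times\Omega\to\mathbb R\ \text{prog. measurable},\ \mathbb E\int_0^T|f_t|^2dt<\infty\Big\},\qquad \langle f,g\rangle=\mathbb E\int_0^Tf_tg_t\,dt ,$$ $$\mathcal L^\infty(\Omega,L^2([0,T]))=\Big\{f:[0,T]\times\Omega\to\mathbb R\ \text{prog. measurable},\ \operatorname*{ess\,sup}_{\omega\in\Omega}\|f(\omega)\|_{L^2([0,T])}<\infty\Big\},$$ with processes identified when they are equal $dt\otimes\mathbb P$-a.e. Let $X_0>0$, $\phi,\varrho\ge0$, let $S\in\mathcal L^2$ with $S_T\in L^2(\Omega,\mathcal F_T,\mathbb P)$, let $\alpha_t=\mathbb E_t[S_T-S_t]$ (progressively measurable version), let $g$ be a process, $h:\mathbb R\to\mathbb R$ a function and $G:[0,T]^2\to\mathbb R$ a measurable Volterra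 kernel that is admissible, i.e. $\sup_{t\in[0,T]}\int_0^t|G(t,s)|^2ds<\infty$. For such a kernel $K$ and $u\in\mathcal L^2$ put $$(\mathbf Ku)_t=\int_0^tK(t,s)u_s\,ds,\qquad(\mathbf K^*u)_t=\int_t^TK(s,t)\,\mathbb E_t[u_s]\,ds .$$ For $\gamma>0$ and $u\in\mathcal L^2$ let $Z^u=g+\mathbf Gu$, $X^u_t=X_0+\int_0^tu_s\,ds$, $S^u_t=S_t+\frac\gamma2u_t+h(Z^u_t)$ and $$\mathcal J(u)=\mathbb E\Big[-\int_0^TS^u_tu_t\,dt+X^u_TS_T-\frac\phi2\int_0^T(X^u_t)^2dt-\frac\varrho2(X^u_T)^2\Big].$$ A strategy $\hat u\in\mathcal L^2$ is *optimal* if $\mathcal J(\hat u)=\sup_{u\in\mathcal L^2}\mathcal J(u)$. Let $H_{\phi,\varrho}(t,s)=(\phi(T-t)+\varrho)\mathbf 1_{\{t>s\}}$ and $\mathbf A(u)=h(Z^u)+\mathbf G^*(h'(Z^u)u)$, and consider the nonlinear stochastic Fredholm equation $$\gamma u_t+(\mathbf A(u))_t+(\mathbf H_{\phi,\varrho}u)_t+(\mathbf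 H_{\phi,\varrho}^*u)_t=\alpha_t-X_0(\phi(T-t)+\varrho),\qquad (dt\otimes\mathbb P)\text{-a.e.}\tag{F}$$ **Theorem.** Assume that $\alpha,g\in\mathcal L^\infty(\Omega,L^2([0,T]))$; that $h$ is differentiable with bounded and Lipschitz continuous derivative, and grows strictly sublinearly, i.e. $|h(x)|\le C(1+|x|^\zeta)$ for all $x\in\mathbb R$, for some $C$ and some $0<\zeta<1$; and that $G$ is positive semi-definite, i.e. $\langle u,\mathbf Gu\rangle\ge0$ for all $u\in\mathcal L^2$, with $$\sup_{t\in[0,T]}\int_t^T|G(s,t)|^2ds<\infty .$$ Then there is $\gamma_0>0$, depending on the data above, such that for every $\gamma\ge\gamma_0$ there exists a unique optimal strategy $\hat u\in\mathcal L^2$ for $\mathcal J$. Moreover $\hat u\in\mathcal L^\infty(\Omega,L^2([0,T]))$, and $\hat u$ is the unique solution in $\mathcal L^2$ of the equation (F). -/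

import Mathlib

open MeasureTheory Set
open scoped ENNReal NNReal

noncomputable section

namespace OptimalTrading

/-- The trading period `[0, T]`, used as the index set of all processes and kernels. -/
abbrev Period (T : ℝ) : Type := Icc (0 : ℝ) T

/-- The Lebesgue measure `dt` on the Borel sets of `[0, T]`. -/
def leb (T : ℝ) : Measure (Period T) := (volume : Measure ℝ).comap Subtype.val

variable {Ω : Type*} [MeasurableSpace Ω] {T : ℝ}

/-- The usual conditions: the filtration is right-continuous and every `ℱ t` contains all the
null sets. (Sets `s` below are arbitrary, so that the underlying space is complete as well.) -/
def UsualConditions (P : Measure Ω) (ℱ : Filtration (Period T) ‹MeasurableSpace Ω›) : Prop :=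
  ℱ.IsRightContinuous ∧ ∀ s : Set Ω, P s = 0 → ∀ t, MeasurableSet[ℱ t] s

/-- The space `𝓛²`: progressively measurable processes `u` with `𝔼 ∫₀ᵀ |u_t|² dt < ∞`.
Elements are identified when they agree `dt ⊗ P`-a.e., see `AEEq`. -/
def IsL2 (P : Measure Ω) (ℱ : Filtration (Period T) ‹MeasurableSpace Ω›)
    (u : Period T → Ω → ℝ) : Prop :=
  IsStronglyProgressive ℱ u ∧ ∫⁻ ω, ∫⁻ t, ‖u t ω‖ₑ ^ 2 ∂(leb T) ∂P < ∞

/-- The space `𝓛^∞(Ω, L²([0,T]))`: progressively measurable processes `u` with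
`ess sup_ω ‖u(ω)‖_{L²([0,T])} < ∞`. -/
def IsLinfL2 (P : Measure Ω) (ℱ : Filtration (Period T) ‹MeasurableSpace Ω›)
    (u : Period T → Ω → ℝ) : Prop :=
  IsStronglyProgressive ℱ u ∧ essSup (fun ω => eLpNorm (fun t => u t ω) 2 (leb T)) P < ∞

/-- Equality of two processes `dt ⊗ P`-almost everywhere. -/
def AEEq (P : Measure Ω) (u v : Period T → Ω → ℝ) : Prop :=
  ∀ᵐ p ∂((leb T).prod P), u p.1 p.2 = v p.1 p.2

/-- The inner product `⟨u, v⟩ = 𝔼 ∫₀ᵀ u_t v_t dt` of `𝓛²`. -/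
def inner2 (P : Measure Ω) (u v : Period T → Ω → ℝ) : ℝ :=
  ∫ ω, ∫ t, u t ω * v t ω ∂(leb T) ∂P

/-- The constant `C_G = sup_t ∫₀ᵗ |G(t,s)|² ds`, with values in `[0, ∞]`. -/
def kernelConst (G : Period T → Period T → ℝ) : ℝ≥0∞ :=
  ⨆ t, ∫⁻ s in Iic t, ‖G t s‖ₑ ^ 2 ∂(leb T)

/-- The constant `C_G^* = sup_t ∫ₜᵀ |G(s,t)|² ds` of the adjoint, with values in `[0, ∞]`. -/
def adjKernelConst (G : Period T → Period T → ℝ) : ℝ≥0∞ :=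
  ⨆ t, ∫⁻ s in Ici t, ‖G s t‖ₑ ^ 2 ∂(leb T)

/-- The (Borel) kernel `G` is admissible: `sup_t ∫₀ᵗ |G(t,s)|² ds < ∞`. Only the values `G(t,s)`
with `s ≤ t` enter any of the definitions, as is usual for Volterra kernels. -/
def AdmissibleKernel (G : Period T → Period T → ℝ) : Prop :=
  Measurable (Function.uncurry G) ∧ kernelConst G < ∞

/-- The Volterra operator `(𝐆u)_t = ∫₀ᵗ G(t,s) u_s ds`. -/
def volterra (G : Period T → Period T → ℝ) (u : Period T → Ω → ℝ) : Period T → Ω → ℝ :=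
  fun t ω => ∫ s in Iic t, G t s * u s ω ∂(leb T)

/-- The adjoint operator `(𝐆^*u)_t = ∫ₜᵀ G(s,t) 𝔼_t[u_s] ds`, where `𝔼_t` is the conditional
expectation given `ℱ t`. -/
def volterraAdj (P : Measure Ω) (ℱ : Filtration (Period T) ‹MeasurableSpace Ω›)
    (G : Period T → Period T → ℝ) (u : Period T → Ω → ℝ) : Period T → Ω → ℝ :=
  fun t ω => ∫ s in Ici t, G s t * (P[u s | ℱ t]) ω ∂(leb T)

/-- The operator `𝐆` on `𝓛²` is positive semi-definite: `⟨u, 𝐆u⟩ ≥ 0` for all `u ∈ 𝓛²`. -/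
def PosSemidefKernel (P : Measure Ω) (ℱ : Filtration (Period T) ‹MeasurableSpace Ω›)
    (G : Period T → Period T → ℝ) : Prop :=
  ∀ u : Period T → Ω → ℝ, IsL2 P ℱ u → 0 ≤ inner2 P u (volterra G u)

/-- `h` grows strictly sublinearly: `|h(x)| = O(1 + |x|^ζ)` on `ℝ`, for some `0 < ζ < 1`. -/
def StrictlySublinear (h : ℝ → ℝ) : Prop :=
  ∃ ζ : ℝ, 0 < ζ ∧ ζ < 1 ∧ ∃ C : ℝ, ∀ x, |h x| ≤ C * (1 + |x| ^ ζ)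

/-- The process `Z^u_t = g_t + (𝐆u)_t`. -/
def impactState (G : Period T → Period T → ℝ) (g u : Period T → Ω → ℝ) : Period T → Ω → ℝ :=
  fun t ω => g t ω + volterra G u t ω

/-- The inventory `X^u_t = X₀ + ∫₀ᵗ u_s ds`. -/
def inventory (X₀ : ℝ) (u : Period T → Ω → ℝ) : Period T → Ω → ℝ :=
  fun t ω => X₀ + ∫ s in Iic t, u s ω ∂(leb T)

/-- The execution price `S^u_t = S_t + (γ/2) u_t + h(Z^u_t)`. -/
def execPrice (γ : ℝ) (h : ℝ → ℝ) (G : Period T → Period T → ℝ) (g S u : Period T → Ω → ℝ) :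
    Period T → Ω → ℝ :=
  fun t ω => S t ω + γ / 2 * u t ω + h (impactState G g u t ω)

/-- The final time `T`, as an element of `[0, T]`. -/
def finalTime (hT : 0 < T) : Period T := ⟨T, hT.le, le_rfl⟩

/-- The performance functional
`𝓙(u) = 𝔼[-∫₀ᵀ S^u_t u_t dt + X^u_T S_T - (φ/2) ∫₀ᵀ (X^u_t)² dt - (ϱ/2) (X^u_T)²]`. -/
def performance (P : Measure Ω) (hT : 0 < T) (X₀ φ ϱ γ : ℝ) (h : ℝ → ℝ)
    (G : Period T → Period T → ℝ) (g S u : Period T → Ω → ℝ) : ℝ :=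
  ∫ ω, (-(∫ t, execPrice γ h G g S u t ω * u t ω ∂(leb T))
    + inventory X₀ u (finalTime hT) ω * S (finalTime hT) ω
    - φ / 2 * ∫ t, inventory X₀ u t ω ^ 2 ∂(leb T)
    - ϱ / 2 * inventory X₀ u (finalTime hT) ω ^ 2) ∂P

/-- `û` is an optimal strategy: `û ∈ 𝓛²` and `𝓙(û) = sup_{u ∈ 𝓛²} 𝓙(u)`. -/
def IsOptimal (P : Measure Ω) (ℱ : Filtration (Period T) ‹MeasurableSpace Ω›) (hT : 0 < T)
    (X₀ φ ϱ γ : ℝ) (h : ℝ → ℝ) (G : Period T → Period T → ℝ) (g S û : Period T → Ω → ℝ) :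
    Prop :=
  IsL2 P ℱ û ∧ ∀ u : Period T → Ω → ℝ, IsL2 P ℱ u →
    performance P hT X₀ φ ϱ γ h G g S u ≤ performance P hT X₀ φ ϱ γ h G g S û

/-- `α` is (a progressively measurable version of) the signal `α_t = 𝔼_t[S_T - S_t]`. -/
def IsAlphaSignal (P : Measure Ω) (ℱ : Filtration (Period T) ‹MeasurableSpace Ω›) (hT : 0 < T)
    (S α : Period T → Ω → ℝ) : Prop :=
  IsStronglyProgressive ℱ α ∧
    ∀ᵐ t ∂(leb T), α t =ᵐ[P] P[fun ω => S (finalTime hT) ω - S t ω | ℱ t]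

/-- The operator `𝐀(u)_t = h(Z^u_t) + (𝐆^*(h'(Z^u) u))_t`. -/
def opA (P : Measure Ω) (ℱ : Filtration (Period T) ‹MeasurableSpace Ω›) (h : ℝ → ℝ)
    (G : Period T → Period T → ℝ) (g u : Period T → Ω → ℝ) : Period T → Ω → ℝ :=
  fun t ω => h (impactState G g u t ω) +
    volterraAdj P ℱ G (fun s ω' => deriv h (impactState G g u s ω') * u s ω') t ω

/-- The kernel `H_{φ,ϱ}(t,s) = (φ (T - t) + ϱ) 1_{t > s}`. -/
def kernelH (φ ϱ : ℝ) : Period T → Period T → ℝ :=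
  fun t s => if s < t then φ * (T - t) + ϱ else 0

/-- `u` is a solution of the nonlinear stochastic Fredholm equation
`γ u_t + 𝐀(u)_t + (𝐇u)_t + (𝐇^*u)_t = α_t - X₀ (φ (T - t) + ϱ)`, `dt ⊗ P`-a.e.,
where `𝐇` is the operator with kernel `H_{φ,ϱ}`. -/
def SolvesFredholm (P : Measure Ω) (ℱ : Filtration (Period T) ‹MeasurableSpace Ω›)
    (X₀ φ ϱ γ : ℝ) (h : ℝ → ℝ) (G : Period T → Period T → ℝ) (g α u : Period T → Ω → ℝ) :
    Prop :=
  AEEq P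
    (fun t ω => γ * u t ω + opA P ℱ h G g u t ω + volterra (kernelH φ ϱ) u t ω
      + volterraAdj P ℱ (kernelH φ ϱ) u t ω)
    (fun t ω => α t ω - X₀ * (φ * (T - t) + ϱ))

end OptimalTrading

end

open MeasureTheory Set
open scoped ENNReal NNReal

noncomputable section

set_option linter.unusedSectionVars false

/-! Dividing (F) by `γ` turns it into a fixed point equation `u = γ⁻¹(F - 𝐀(u) - 𝐇u - 𝐇^*u)`, so
large `γ` should make the right-hand side a contraction. The obstacle is the product `h'(Z^u)u`,
which is not evidently Lipschitz on `𝓛²`. Writing the difference of two such products as `h'(Z^u)(u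
- v) + (h'(Z^u) - h'(Z^v))v`, the second term is at most `L |Z^u - Z^v| |v|`, and `sup_t |Z^u_t -
Z^v_t|` is bounded pathwise by the `L²([0,T])` norm of `u - v`. A pathwise bound on `v` alone
therefore suffices (`RegularData.pathNormSq_weightedProc_sub_le`). The iteration runs in the unit
ball of `𝓛^∞(Ω, L²)`, in the `𝓛²` distance (`exists_fixedPoint`). As only one of the two processes
must lie in the ball, the fixed point is unique in all of `𝓛²`.

For optimality, expand `𝓙` around the fixed point `û`. The adjoint relation `inner2_volterra`,
together with `inner2_alpha`, identifies the first variation in direction `b` with the inner product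
of `b` and the residual of (F), hence it vanishes. The inventory penalties are concave, and the
second-order errors from `h` are bounded by a constant times `‖b‖²` (`integral_impact_cost_le`).
This gives `𝓙(u) ≤ 𝓙(û) + (c - γ/2)‖u - û‖²` (`performance_le`), which for `γ > 2c` yields both
optimality and uniqueness of the optimiser.

Countability of `Ω` enters through atoms: a process is progressive iff its paths are Borel and it is
constant on the atoms of the filtration, and conditional expectations are averages over atoms.
Almost-everywhere statements become statements about almost every `t` on each path of positive
probability. -/

namespace OptimalTrading

/-! ### Lebesgue measure on the period. -/

section Lebesgue

variable {T : ℝ}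

lemma leb_image (s : Set (Period T)) : leb T s = volume (Subtype.val '' s) :=
  comap_subtype_coe_apply measurableSet_Icc _ _

lemma leb_univ : leb T univ = ENNReal.ofReal T := by
  rw [leb_image, image_univ, Subtype.range_coe, Real.volume_Icc, sub_zero]

instance : IsFiniteMeasure (leb T) := ⟨by rw [leb_univ]; exact ENNReal.ofReal_lt_top⟩

lemma leb_Ici (t : Period T) : leb T (Ici t) = ENNReal.ofReal (T - t) := by
  rw [leb_image]
  have : Subtype.val '' (Ici t) = Icc (t : ℝ) T := by
    ext x
    constructor
    · rintro ⟨y, hy, rfl⟩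
      exact ⟨hy, y.2.2⟩
    · rintro ⟨h1, h2⟩
      exact ⟨⟨x, t.2.1.trans h1, h2⟩, h1, rfl⟩
  rw [this, Real.volume_Icc]

instance : NullSingletonClass (leb T) := ⟨fun x => by rw [leb_image, image_singleton]; simp⟩

end Lebesgue

/-! ### Cauchy–Schwarz and elementary bounds for extended norms. -/

section Inequalities

variable {X : Type*} [MeasurableSpace X]

lemma lintegral_mul_sq_le (ν : Measure X) {f g : X → ℝ≥0∞} (hf : AEMeasurable f ν)
    (hg : AEMeasurable g ν) :
    (∫⁻ x, f x * g x ∂ν) ^ 2 ≤ (∫⁻ x, f x ^ 2 ∂ν) * ∫⁻ x, g x ^ 2 ∂ν := by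
  have h := ENNReal.lintegral_mul_le_Lp_mul_Lq ν Real.HolderConjugate.two_two hf hg
  simp only [Pi.mul_apply] at h
  calc (∫⁻ x, f x * g x ∂ν) ^ 2
      ≤ ((∫⁻ x, f x ^ (2 : ℝ) ∂ν) ^ (1 / 2 : ℝ) * (∫⁻ x, g x ^ (2 : ℝ) ∂ν) ^ (1 / 2 : ℝ)) ^ 2 := by
        gcongr
    _ = _ := by
        rw [mul_pow, ← ENNReal.rpow_natCast, ← ENNReal.rpow_natCast, ← ENNReal.rpow_mul,
          ← ENNReal.rpow_mul]
        simp

lemma enorm_integral_mul_sq_le (ν : Measure X) {f g : X → ℝ} (hf : AEMeasurable f ν)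
    (hg : AEMeasurable g ν) :
    ‖∫ x, f x * g x ∂ν‖ₑ ^ 2 ≤ (∫⁻ x, ‖f x‖ₑ ^ 2 ∂ν) * ∫⁻ x, ‖g x‖ₑ ^ 2 ∂ν := by
  refine le_trans ?_ (lintegral_mul_sq_le ν hf.enorm hg.enorm)
  gcongr
  refine (enorm_integral_le_lintegral_enorm _).trans_eq ?_
  simp_rw [enorm_mul]

lemma enorm_add_sq_le (a b : ℝ) : ‖a + b‖ₑ ^ 2 ≤ 2 * (‖a‖ₑ ^ 2 + ‖b‖ₑ ^ 2) := by
  simp only [Real.enorm_eq_ofReal_abs]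
  rw [← ENNReal.ofReal_pow (abs_nonneg _), ← ENNReal.ofReal_pow (abs_nonneg _),
    ← ENNReal.ofReal_pow (abs_nonneg _), ← ENNReal.ofReal_add (by positivity) (by positivity),
    show (2 : ℝ≥0∞) = ENNReal.ofReal 2 by simp, ← ENNReal.ofReal_mul (by norm_num)]
  apply ENNReal.ofReal_le_ofReal
  simp only [sq_abs]
  nlinarith [sq_nonneg (a - b)]

lemma enorm_sub_sq_le (a b : ℝ) : ‖a - b‖ₑ ^ 2 ≤ 2 * (‖a‖ₑ ^ 2 + ‖b‖ₑ ^ 2) := by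
  have := enorm_add_sq_le a (-b)
  rwa [enorm_neg, ← sub_eq_add_neg] at this

lemma enorm_sq_eq (a : ℝ) : ‖a‖ₑ ^ 2 = ENNReal.ofReal (a ^ 2) := by
  rw [Real.enorm_eq_ofReal_abs, ← ENNReal.ofReal_pow (abs_nonneg _), sq_abs]

end Inequalities

/-! ### Atoms of the filtration and progressive measurability. -/

section Atoms

variable {Ω : Type*} [MeasurableSpace Ω] {T : ℝ}

/-- The atom of `ℱ t` that contains `ω`. -/
def atom (ℱ : Filtration (Period T) ‹MeasurableSpace Ω›) (t : Period T) (ω : Ω) : Set Ω :=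
  @measurableAtom Ω (ℱ t) ω

variable {ℱ : Filtration (Period T) ‹MeasurableSpace Ω›}

lemma mem_atom_self (t : Period T) (ω : Ω) : ω ∈ atom ℱ t ω :=
  @mem_measurableAtom_self Ω (ℱ t) ω

lemma atom_eq_of_mem {t : Period T} {ω ω' : Ω} (h : ω' ∈ atom ℱ t ω) :
    atom ℱ t ω' = atom ℱ t ω :=
  @measurableAtom_eq_of_mem Ω (ℱ t) ω' ω h

lemma mem_atom_comm {t : Period T} {ω ω' : Ω} : ω' ∈ atom ℱ t ω ↔ ω ∈ atom ℱ t ω' :=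
  ⟨fun h => atom_eq_of_mem h ▸ mem_atom_self t ω, fun h => atom_eq_of_mem h ▸ mem_atom_self t ω'⟩

/-- A larger σ-algebra separates more points. This monotonicity in time is the source of all joint
measurability of conditional quantities below. -/
lemma atom_anti {s t : Period T} (h : s ≤ t) (ω : Ω) : atom ℱ t ω ⊆ atom ℱ s ω := by
  intro ω' hω'
  simp only [atom, measurableAtom, mem_iInter] at hω' ⊢
  exact fun A hA hmA => hω' A hA (ℱ.mono h A hmA)

lemma measurableSet_atom [Countable Ω] (t : Period T) (ω : Ω) :
    MeasurableSet[ℱ t] (atom ℱ t ω) :=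
  @MeasurableSet.measurableAtom_of_countable Ω (ℱ t) _ ω

lemma eq_of_mem_atom {t : Period T} {ω ω' : Ω} {β : Type*} [MeasurableSpace β]
    [MeasurableSingletonClass β] {f : Ω → β} (hf : Measurable[ℱ t] f) (h : ω' ∈ atom ℱ t ω) :
    f ω' = f ω :=
  @mem_of_mem_measurableAtom Ω (ℱ t) ω ω' h (f ⁻¹' {f ω}) (hf (measurableSet_singleton _)) rfl

/-- Every preimage is a union of atoms, and countability makes that union measurable. -/
lemma measurable_of_const_on_atoms [Countable Ω] {t : Period T} {β : Type*} [MeasurableSpace β]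
    {f : Ω → β} (hf : ∀ ω ω', ω' ∈ atom ℱ t ω → f ω' = f ω) : Measurable[ℱ t] f := by
  intro B _
  have : f ⁻¹' B = ⋃ ω ∈ f ⁻¹' B, atom ℱ t ω := by
    ext ω'
    simp only [mem_preimage, mem_iUnion]
    constructor
    · exact fun h => ⟨ω', h, mem_atom_self t ω'⟩
    · rintro ⟨ω, h, h'⟩
      rwa [hf ω ω' h']
  rw [this]
  exact MeasurableSet.biUnion (to_countable _) fun ω _ => measurableSet_atom t ω

/-- On a countable space a process is progressive iff its paths are Borel and it is constant on
the atoms of the filtration. -/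
structure IsAdapted (ℱ : Filtration (Period T) ‹MeasurableSpace Ω›) (u : Period T → Ω → ℝ) :
    Prop where
  path : ∀ ω, Measurable fun t => u t ω
  const : ∀ t ω ω', ω' ∈ atom ℱ t ω → u t ω' = u t ω

lemma isStronglyProgressive_iff [Countable Ω] {u : Period T → Ω → ℝ} :
    IsStronglyProgressive ℱ u ↔ IsAdapted ℱ u := by
  constructor
  · intro h
    refine ⟨fun ω => ?_, fun t ω ω' hω => ?_⟩
    · by_cases hT : 0 ≤ T
      · have h1 := (h ⟨T, hT, le_rfl⟩).measurable
        have h2 : Measurable[_, Subtype.instMeasurableSpace.prod (ℱ ⟨T, hT, le_rfl⟩)]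
            fun t : Period T => ((⟨t, t.2.2⟩ : Iic (⟨T, hT, le_rfl⟩ : Period T)), ω) := by
          exact @Measurable.prodMk _ _ _ _ _ (ℱ ⟨T, hT, le_rfl⟩) _ _ measurable_id.subtype_mk
            (@measurable_const _ _ (ℱ ⟨T, hT, le_rfl⟩) _ _)
        exact h1.comp h2
      · have : IsEmpty (Period T) := ⟨fun t => hT (t.2.1.trans t.2.2)⟩
        exact measurable_of_empty _
    · exact eq_of_mem_atom (h.stronglyAdapted t).measurable hω
  · intro h i
    refine Measurable.stronglyMeasurable ?_
    -- Up to time `i` the process must be constant on atoms of `ℱ i`; these refine the atoms of `ℱ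
    -- t` for `t ≤ i`.
    refine @measurable_from_prod_countable_left' (Iic i) Ω ℝ _ (ℱ i) _ _ _ (fun ω => ?_) ?_
    · exact (h.path ω).comp measurable_subtype_coe
    · intro ω ω' t hω
      exact h.const _ _ _ (atom_anti t.2 ω hω)

lemma IsAdapted.measurable_uncurry [Countable Ω] [DiscreteMeasurableSpace Ω]
    {u : Period T → Ω → ℝ} (h : IsAdapted ℱ u) : Measurable fun p : Period T × Ω => u p.1 p.2 :=
  measurable_from_prod_countable_left h.path

lemma IsAdapted.map₂ {u v : Period T → Ω → ℝ} (hu : IsAdapted ℱ u) (hv : IsAdapted ℱ v)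
    {F : Period T → ℝ → ℝ → ℝ} (hF : Measurable fun p : Period T × ℝ × ℝ => F p.1 p.2.1 p.2.2) :
    IsAdapted ℱ fun t ω => F t (u t ω) (v t ω) :=
  ⟨fun ω => hF.comp (measurable_id.prodMk ((hu.path ω).prodMk (hv.path ω))),
    fun t ω ω' h => by simp only [hu.const t ω ω' h, hv.const t ω ω' h]⟩

lemma IsAdapted.det {a : Period T → ℝ} (ha : Measurable a) :
    IsAdapted ℱ fun t _ => a t := ⟨fun _ => ha, fun _ _ _ _ => rfl⟩

lemma IsAdapted.add {u v : Period T → Ω → ℝ} (hu : IsAdapted ℱ u) (hv : IsAdapted ℱ v) :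
    IsAdapted ℱ fun t ω => u t ω + v t ω := hu.map₂ hv (F := fun _ a b => a + b) (by fun_prop)

lemma IsAdapted.sub {u v : Period T → Ω → ℝ} (hu : IsAdapted ℱ u) (hv : IsAdapted ℱ v) :
    IsAdapted ℱ fun t ω => u t ω - v t ω := hu.map₂ hv (F := fun _ a b => a - b) (by fun_prop)

lemma IsAdapted.mul {u v : Period T → Ω → ℝ} (hu : IsAdapted ℱ u) (hv : IsAdapted ℱ v) :
    IsAdapted ℱ fun t ω => u t ω * v t ω := hu.map₂ hv (F := fun _ a b => a * b) (by fun_prop)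

lemma IsAdapted.comp {u : Period T → Ω → ℝ} (hu : IsAdapted ℱ u) {f : ℝ → ℝ} (hf : Measurable f) :
    IsAdapted ℱ fun t ω => f (u t ω) := hu.map₂ hu (F := fun _ a _ => f a) (by fun_prop)

variable {P : Measure Ω}

lemma measure_atom_ne_zero {t : Period T} {ω : Ω} (hω : P {ω} ≠ 0) : P (atom ℱ t ω) ≠ 0 :=
  fun h => hω (measure_mono_null (singleton_subset_iff.2 (mem_atom_self t ω)) h)

end Atoms

/-! ### Conditional averages, the Volterra operator and its adjoint. -/

section Operators

variable {Ω : Type*} [MeasurableSpace Ω] {T : ℝ}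

/-- The exceptional set is a countable union of rectangles `A ×ˢ {ω}`, so no measurability of `p` is
needed. It lets the whole argument run path by path. -/
lemma ae_prod_iff_of_countable [Countable Ω] [DiscreteMeasurableSpace Ω] {P : Measure Ω}
    [IsProbabilityMeasure P] {p : Period T → Ω → Prop} :
    (∀ᵐ q ∂((leb T).prod P), p q.1 q.2) ↔ ∀ ω, P {ω} ≠ 0 → ∀ᵐ t ∂(leb T), p t ω := by
  constructor
  · intro h ω hω
    rw [ae_iff] at h ⊢
    have h1 : (leb T).prod P ({t | ¬ p t ω} ×ˢ {ω}) = 0 := by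
      refine measure_mono_null ?_ h
      rintro ⟨t, ω'⟩ ⟨h1, h2⟩
      simp only [mem_singleton_iff] at h2
      subst h2
      exact h1
    rw [Measure.prod_prod, mul_eq_zero] at h1
    exact h1.resolve_right hω
  · intro h
    rw [ae_iff]
    have h1 : {q : Period T × Ω | ¬ p q.1 q.2} ⊆ ⋃ ω, {t | ¬ p t ω} ×ˢ {ω} := by
      rintro ⟨t, ω⟩ hq
      exact mem_iUnion.2 ⟨ω, hq, rfl⟩
    refine measure_mono_null h1 (measure_iUnion_null fun ω => ?_)
    rw [Measure.prod_prod, mul_eq_zero]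
    by_cases hω : P {ω} = 0
    · exact Or.inr hω
    · exact Or.inl (ae_iff.1 (h ω hω))

/-- The pathwise squared norm `∫₀ᵀ |u_t(ω)|² dt`. -/
def pathNormSq (u : Period T → Ω → ℝ) (ω : Ω) : ℝ≥0∞ := ∫⁻ t, ‖u t ω‖ₑ ^ 2 ∂(leb T)

/-- The squared norm of `𝓛²`. -/
def normSq (P : Measure Ω) (u : Period T → Ω → ℝ) : ℝ≥0∞ := ∫⁻ ω, pathNormSq u ω ∂P

/-- The conditional law given `ℱ t`, at the point `ω`; it vanishes if `ω` lies in a null atom. -/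
def condMeas (P : Measure Ω) (ℱ : Filtration (Period T) ‹MeasurableSpace Ω›) (t : Period T)
    (ω : Ω) : Measure Ω := ProbabilityTheory.cond P (atom ℱ t ω)

/-- A version of `𝔼_t[u_s]` that is jointly measurable. -/
def condProc (P : Measure Ω) (ℱ : Filtration (Period T) ‹MeasurableSpace Ω›)
    (u : Period T → Ω → ℝ) (s t : Period T) (ω : Ω) : ℝ := ∫ ω', u s ω' ∂condMeas P ℱ t ω

/-- The version of the adjoint Volterra operator that is built from `condProc`. -/
def adjOp (P : Measure Ω) (ℱ : Filtration (Period T) ‹MeasurableSpace Ω›)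
    (K : Period T → Period T → ℝ) (u : Period T → Ω → ℝ) (t : Period T) (ω : Ω) : ℝ :=
  ∫ s in Ici t, K s t * condProc P ℱ u s t ω ∂(leb T)

/-- The conditional expectation of the pathwise squared norm. -/
def condNormSq (P : Measure Ω) (ℱ : Filtration (Period T) ‹MeasurableSpace Ω›)
    (u : Period T → Ω → ℝ) (t : Period T) (ω : Ω) : ℝ≥0∞ :=
  ∫⁻ ω', pathNormSq u ω' ∂condMeas P ℱ t ω

variable {P : Measure Ω} [IsProbabilityMeasure P] {ℱ : Filtration (Period T) ‹MeasurableSpace Ω›}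

lemma condMeas_congr {t : Period T} {ω ω' : Ω} (h : ω' ∈ atom ℱ t ω) :
    condMeas P ℱ t ω' = condMeas P ℱ t ω := by
  rw [condMeas, condMeas, atom_eq_of_mem h]

lemma condMeas_univ_le (t : Period T) (ω : Ω) : condMeas P ℱ t ω univ ≤ 1 := by
  rw [condMeas, ProbabilityTheory.cond, Measure.smul_apply, Measure.restrict_apply_univ,
    smul_eq_mul]
  exact ENNReal.inv_mul_le_one _

instance (t : Period T) (ω : Ω) : IsFiniteMeasure (condMeas P ℱ t ω) :=
  ⟨(condMeas_univ_le t ω).trans_lt ENNReal.one_lt_top⟩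

lemma lintegral_condMeas (t : Period T) (ω : Ω) (f : Ω → ℝ≥0∞) :
    ∫⁻ ω', f ω' ∂condMeas P ℱ t ω = (P (atom ℱ t ω))⁻¹ * ∫⁻ ω' in atom ℱ t ω, f ω' ∂P := by
  rw [condMeas, ProbabilityTheory.cond, lintegral_smul_measure, smul_eq_mul]

lemma integral_condMeas (t : Period T) (ω : Ω) (f : Ω → ℝ) :
    ∫ ω', f ω' ∂condMeas P ℱ t ω = (P.real (atom ℱ t ω))⁻¹ * ∫ ω' in atom ℱ t ω, f ω' ∂P := by
  rw [condMeas, ProbabilityTheory.cond, integral_smul_measure, smul_eq_mul, ENNReal.toReal_inv,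
    measureReal_def]

variable [Countable Ω] [DiscreteMeasurableSpace Ω]

lemma ae_condMeas_of_forall {t : Period T} {ω : Ω} {p : Ω → Prop} (h : ∀ ω', P {ω'} ≠ 0 → p ω') :
    ∀ᵐ ω' ∂condMeas P ℱ t ω, p ω' := by
  have : ∀ᵐ ω' ∂P, p ω' := ae_iff_of_countable.2 h
  exact ProbabilityTheory.cond_absolutelyContinuous.ae_le this

lemma lintegral_condMeas_ne_top {f : Ω → ℝ≥0∞} (hf : ∫⁻ ω, f ω ∂P ≠ ∞) (t : Period T) (ω : Ω) :
    ∫⁻ ω', f ω' ∂condMeas P ℱ t ω ≠ ∞ := by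
  rw [lintegral_condMeas]
  by_cases h : P (atom ℱ t ω) = 0
  · rw [Measure.restrict_eq_zero.2 h]
    simp
  · refine ENNReal.mul_ne_top (ENNReal.inv_ne_top.2 h) ?_
    exact ((setLIntegral_le_lintegral _ _).trans_lt hf.lt_top).ne

/-- The tower property. -/
lemma lintegral_lintegral_condMeas (t : Period T) (f : Ω → ℝ≥0∞) :
    ∫⁻ ω, ∫⁻ ω', f ω' ∂condMeas P ℱ t ω ∂P = ∫⁻ ω, f ω ∂P := by
  classical
  -- Lying in the same atom is symmetric, so the indicator may be read as a function of `ω` with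
  -- `ω'` fixed. After Tonelli the inner integral is the mass of the atom times its inverse.
  have h1 : ∀ ω, ∫⁻ ω', f ω' ∂condMeas P ℱ t ω =
      ∫⁻ ω', (atom ℱ t ω').indicator (fun _ => (P (atom ℱ t ω'))⁻¹ * f ω') ω ∂P := by
    intro ω
    rw [lintegral_condMeas, ← lintegral_const_mul _ (Measurable.of_discrete),
      ← lintegral_indicator MeasurableSet.of_discrete]
    refine lintegral_congr fun ω' => ?_
    by_cases h : ω' ∈ atom ℱ t ω
    · rw [indicator_of_mem h, indicator_of_mem (mem_atom_comm.1 h), atom_eq_of_mem h]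
    · rw [indicator_of_notMem h, indicator_of_notMem fun h' => h (mem_atom_comm.2 h')]
  simp_rw [h1]
  rw [lintegral_lintegral_swap]
  · refine lintegral_congr_ae (ae_iff_of_countable.2 fun ω hω => ?_)
    simp only
    rw [lintegral_indicator MeasurableSet.of_discrete, setLIntegral_const, mul_right_comm,
      ENNReal.inv_mul_cancel (measure_atom_ne_zero hω) (measure_ne_top _ _), one_mul]
  · exact (measurable_from_prod_countable_left fun _ => Measurable.of_discrete).aemeasurable

/-- The conditional expectation is constant on the atom of `ω`, which has positive mass; integrating
over that atom determines the constant. -/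
lemma condExp_eq_integral_condMeas {f : Ω → ℝ} (hf : Integrable f P) (t : Period T) {ω : Ω}
    (hω : P {ω} ≠ 0) : (P[f | ℱ t]) ω = ∫ ω', f ω' ∂condMeas P ℱ t ω := by
  have h1 := setIntegral_condExp (ℱ.le t) hf (measurableSet_atom t ω)
  have h2 : ∫ ω' in atom ℱ t ω, (P[f | ℱ t]) ω' ∂P = ∫ _ in atom ℱ t ω, (P[f | ℱ t]) ω ∂P :=
    setIntegral_congr_fun MeasurableSet.of_discrete fun ω' hω' =>
      eq_of_mem_atom stronglyMeasurable_condExp.measurable hω'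
  rw [setIntegral_const, smul_eq_mul, h1] at h2
  rw [integral_condMeas, h2, inv_mul_cancel_left₀]
  exact (measureReal_ne_zero_iff (measure_ne_top _ _)).2 (measure_atom_ne_zero hω)

lemma enorm_integral_condMeas_sq_le (f : Ω → ℝ) (t : Period T) (ω : Ω) :
    ‖∫ ω', f ω' ∂condMeas P ℱ t ω‖ₑ ^ 2 ≤ ∫⁻ ω', ‖f ω'‖ₑ ^ 2 ∂condMeas P ℱ t ω := by
  have h := enorm_integral_mul_sq_le (condMeas P ℱ t ω) (f := f) (g := fun _ => 1)
    Measurable.of_discrete.aemeasurable aemeasurable_const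
  simp only [mul_one, enorm_one, one_pow, lintegral_const, one_mul] at h
  exact h.trans (mul_le_of_le_one_right' (condMeas_univ_le t ω))

/-- Atoms shrink with time: their mass is antitone in `t`, and the times at which `ω'` still shares
the atom of `ω` form a lower set. Both are therefore Borel in `t`. -/
lemma measurable_condProc {u : Period T → Ω → ℝ} (hu : ∀ ω, Measurable fun t => u t ω) :
    Measurable fun p : (Period T × Period T) × Ω => condProc P ℱ u p.1.1 p.1.2 p.2 := by
  refine measurable_from_prod_countable_left fun ω => ?_
  simp only [condProc, integral_condMeas]
  refine Measurable.mul (Measurable.inv ?_) ?_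
  · have : Antitone fun t : Period T => P.real (atom ℱ t ω) :=
      fun s t hst => measureReal_mono (atom_anti hst ω)
    exact this.measurable.comp measurable_snd
  · simp_rw [← integral_indicator (MeasurableSet.of_discrete (s := atom ℱ _ ω))]
    refine (StronglyMeasurable.integral_prod_right' (ν := P)
      (f := fun q : (Period T × Period T) × Ω => (atom ℱ q.1.2 ω).indicator (u q.1.1) q.2)
      (Measurable.stronglyMeasurable ?_)).measurable
    refine measurable_from_prod_countable_left fun ω' => ?_
    have hset : MeasurableSet {p : Period T × Period T | ω' ∈ atom ℱ p.2 ω} := by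
      have : IsLowerSet {t : Period T | ω' ∈ atom ℱ t ω} := fun s t hts hs => atom_anti hts ω hs
      exact measurable_snd this.ordConnected.measurableSet
    exact Measurable.indicator (f := fun p : Period T × Period T => u p.1 ω')
      ((hu ω').comp measurable_fst) hset

lemma measurable_pathNormSq_of_discrete (u : Period T → Ω → ℝ) : Measurable (pathNormSq u) :=
  Measurable.of_discrete

/-- Jensen's inequality under the conditional law, then Tonelli. -/
lemma lintegral_condProc_sq_le {u : Period T → Ω → ℝ} (hu : ∀ ω, Measurable fun t => u t ω)
    (t : Period T) (ω : Ω) :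
    ∫⁻ s, ‖condProc P ℱ u s t ω‖ₑ ^ 2 ∂(leb T) ≤ condNormSq P ℱ u t ω := by
  refine (lintegral_mono fun s => enorm_integral_condMeas_sq_le (u s) t ω).trans_eq ?_
  rw [lintegral_lintegral_swap]
  · rfl
  · exact ((measurable_from_prod_countable_left (f := fun p : Period T × Ω => u p.1 p.2)
      hu).enorm.pow_const 2).aemeasurable

lemma IsL2.isAdapted {u : Period T → Ω → ℝ} (h : IsL2 P ℱ u) : IsAdapted ℱ u :=
  isStronglyProgressive_iff.1 h.1

lemma isL2_iff {u : Period T → Ω → ℝ} : IsL2 P ℱ u ↔ IsAdapted ℱ u ∧ normSq P u < ∞ := by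
  rw [IsL2, isStronglyProgressive_iff]
  rfl

lemma pathNormSq_ne_top {u : Period T → Ω → ℝ} (h : normSq P u ≠ ∞) {ω : Ω} (hω : P {ω} ≠ 0) :
    pathNormSq u ω ≠ ∞ :=
  (ae_iff_of_countable.1 (ae_lt_top (measurable_pathNormSq_of_discrete u) h) ω hω).ne

lemma condNormSq_ne_top {u : Period T → Ω → ℝ} (h : normSq P u ≠ ∞) (t : Period T) (ω : Ω) :
    condNormSq P ℱ u t ω ≠ ∞ := lintegral_condMeas_ne_top h t ω

lemma pathNormSq_add_le {u v : Period T → Ω → ℝ} {ω : Ω} (hu : Measurable fun t => u t ω) :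
    pathNormSq (fun t ω => u t ω + v t ω) ω ≤ 2 * (pathNormSq u ω + pathNormSq v ω) := by
  refine (lintegral_mono fun t => enorm_add_sq_le (u t ω) (v t ω)).trans_eq ?_
  rw [lintegral_const_mul' _ _ (by simp), lintegral_add_left (hu.enorm.pow_const 2)]
  rfl

lemma pathNormSq_sub_le {u v : Period T → Ω → ℝ} {ω : Ω} (hu : Measurable fun t => u t ω) :
    pathNormSq (fun t ω => u t ω - v t ω) ω ≤ 2 * (pathNormSq u ω + pathNormSq v ω) := by
  refine (lintegral_mono fun t => enorm_sub_sq_le (u t ω) (v t ω)).trans_eq ?_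
  rw [lintegral_const_mul' _ _ (by simp), lintegral_add_left (hu.enorm.pow_const 2)]
  rfl

lemma normSq_add_le {u v : Period T → Ω → ℝ} (hu : IsAdapted ℱ u) :
    normSq P (fun t ω => u t ω + v t ω) ≤ 2 * (normSq P u + normSq P v) := by
  refine (lintegral_mono fun ω => pathNormSq_add_le (hu.path ω)).trans_eq ?_
  rw [lintegral_const_mul' _ _ (by simp), lintegral_add_left Measurable.of_discrete]
  rfl

lemma normSq_sub_le {u v : Period T → Ω → ℝ} (hu : IsAdapted ℱ u) :
    normSq P (fun t ω => u t ω - v t ω) ≤ 2 * (normSq P u + normSq P v) := by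
  refine (lintegral_mono fun ω => pathNormSq_sub_le (hu.path ω)).trans_eq ?_
  rw [lintegral_const_mul' _ _ (by simp), lintegral_add_left Measurable.of_discrete]
  rfl

lemma IsL2.add {u v : Period T → Ω → ℝ} (hu : IsL2 P ℱ u) (hv : IsL2 P ℱ v) :
    IsL2 P ℱ fun t ω => u t ω + v t ω := by
  rw [isL2_iff] at *
  exact ⟨hu.1.add hv.1, (normSq_add_le hu.1).trans_lt (by finiteness [hu.2.ne, hv.2.ne])⟩

lemma IsL2.sub {u v : Period T → Ω → ℝ} (hu : IsL2 P ℱ u) (hv : IsL2 P ℱ v) :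
    IsL2 P ℱ fun t ω => u t ω - v t ω := by
  rw [isL2_iff] at *
  exact ⟨hu.1.sub hv.1, (normSq_sub_le hu.1).trans_lt (by finiteness [hu.2.ne, hv.2.ne])⟩

lemma ae_integrable_condMeas {u : Period T → Ω → ℝ} (hu : IsL2 P ℱ u) (t : Period T) (ω : Ω) :
    ∀ᵐ s ∂(leb T), Integrable (u s) (condMeas P ℱ t ω) := by
  have hm : Measurable fun p : Period T × Ω => u p.1 p.2 := hu.isAdapted.measurable_uncurry
  have h1 : ∫⁻ s, ∫⁻ ω', ‖u s ω'‖ₑ ^ 2 ∂condMeas P ℱ t ω ∂(leb T) ≠ ∞ := by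
    rw [lintegral_lintegral_swap (hm.enorm.pow_const 2).aemeasurable]
    exact condNormSq_ne_top hu.2.ne t ω
  have h2 : Measurable fun s => ∫⁻ ω', ‖u s ω'‖ₑ ^ 2 ∂condMeas P ℱ t ω :=
    (hm.enorm.pow_const 2).lintegral_prod_right'
  filter_upwards [ae_lt_top h2 h1] with s hs
  have : MemLp (u s) 2 (condMeas P ℱ t ω) := by
    refine ⟨Measurable.of_discrete.aestronglyMeasurable, ?_⟩
    rw [eLpNorm_lt_top_iff_lintegral_rpow_enorm_lt_top (by simp) (by simp)]
    simpa using hs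
  exact this.integrable (by norm_num)

lemma ae_memLp_slice {u : Period T → Ω → ℝ} (hu : IsL2 P ℱ u) :
    ∀ᵐ s ∂(leb T), MemLp (u s) 2 P := by
  have hm : Measurable fun p : Period T × Ω => u p.1 p.2 := hu.isAdapted.measurable_uncurry
  have h1 : ∫⁻ s, ∫⁻ ω', ‖u s ω'‖ₑ ^ 2 ∂P ∂(leb T) ≠ ∞ := by
    rw [lintegral_lintegral_swap (hm.enorm.pow_const 2).aemeasurable]
    exact hu.2.ne
  have h2 : Measurable fun s => ∫⁻ ω', ‖u s ω'‖ₑ ^ 2 ∂P :=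
    (hm.enorm.pow_const 2).lintegral_prod_right'
  filter_upwards [ae_lt_top h2 h1] with s hs
  refine ⟨Measurable.of_discrete.aestronglyMeasurable, ?_⟩
  rw [eLpNorm_lt_top_iff_lintegral_rpow_enorm_lt_top (by simp) (by simp)]
  simpa using hs

/-- The two integrands can differ only at times `s` where `u s` is not square integrable, a null set
of times. -/
lemma volterraAdj_eq_adjOp {u : Period T → Ω → ℝ} (hu : IsL2 P ℱ u) (K : Period T → Period T → ℝ)
    (t : Period T) {ω : Ω} (hω : P {ω} ≠ 0) : volterraAdj P ℱ K u t ω = adjOp P ℱ K u t ω := by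
  refine integral_congr_ae (ae_restrict_of_ae ?_)
  filter_upwards [ae_memLp_slice hu] with s hs
  rw [condExp_eq_integral_condMeas (hs.integrable (by norm_num)) t hω]
  rfl

/-- The constants of a kernel and its adjoint are both finite. -/
structure IsGoodKernel (K : Period T → Period T → ℝ) : Prop where
  meas : Measurable (Function.uncurry K)
  const : kernelConst K ≠ ∞
  adjConst : adjKernelConst K ≠ ∞

lemma IsAdapted.volterra {K : Period T → Period T → ℝ} (hK : Measurable (Function.uncurry K))
    {u : Period T → Ω → ℝ} (hu : IsAdapted ℱ u) : IsAdapted ℱ (volterra K u) := by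
  refine ⟨fun ω => ?_, fun t ω ω' h => ?_⟩
  · simp only [OptimalTrading.volterra, ← integral_indicator measurableSet_Iic]
    refine (StronglyMeasurable.integral_prod_right' (ν := leb T)
      (f := fun p : Period T × Period T => (Iic p.1).indicator (fun s => K p.1 s * u s ω) p.2)
      (Measurable.stronglyMeasurable ?_)).measurable
    exact Measurable.indicator (f := fun p : Period T × Period T => K p.1 p.2 * u p.2 ω)
      (hK.mul ((hu.path ω).comp measurable_snd)) (measurableSet_le measurable_snd measurable_fst)
  · refine setIntegral_congr_fun measurableSet_Iic fun s hs => ?_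
    rw [hu.const s ω ω' (atom_anti hs ω h)]

lemma IsAdapted.adjOp {K : Period T → Period T → ℝ} (hK : Measurable (Function.uncurry K))
    {u : Period T → Ω → ℝ} (hu : IsAdapted ℱ u) : IsAdapted ℱ (adjOp P ℱ K u) := by
  refine ⟨fun ω => ?_, fun t ω ω' h => ?_⟩
  · simp only [OptimalTrading.adjOp, ← integral_indicator measurableSet_Ici]
    refine (StronglyMeasurable.integral_prod_right' (ν := leb T)
      (f := fun p : Period T × Period T =>
        (Ici p.1).indicator (fun s => K s p.1 * condProc P ℱ u s p.1 ω) p.2)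
      (Measurable.stronglyMeasurable ?_)).measurable
    refine Measurable.indicator
      (f := fun p : Period T × Period T => K p.2 p.1 * condProc P ℱ u p.2 p.1 ω)
      ((hK.comp measurable_swap).mul ?_) (measurableSet_le measurable_fst measurable_snd)
    exact (measurable_condProc hu.path).comp
      (g := fun p : (Period T × Period T) × Ω => condProc P ℱ u p.1.1 p.1.2 p.2)
      (f := fun p : Period T × Period T => ((p.2, p.1), ω)) (by fun_prop)
  · simp only [OptimalTrading.adjOp, condProc, condMeas_congr h]

/-- Cauchy–Schwarz in `s`. The bound is pathwise and uniform in `t`, which is what controls products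
such as `h'(Z^u)u`. -/
lemma enorm_volterra_sq_le {K : Period T → Period T → ℝ} (hK : Measurable (Function.uncurry K))
    {u : Period T → Ω → ℝ} {ω : Ω} (hu : Measurable fun t => u t ω) (t : Period T) :
    ‖volterra K u t ω‖ₑ ^ 2 ≤ kernelConst K * pathNormSq u ω := by
  refine (enorm_integral_mul_sq_le _ (hK.comp measurable_prodMk_left).aemeasurable
    hu.aemeasurable).trans ?_
  exact mul_le_mul' (le_iSup (fun t => ∫⁻ s in Iic t, ‖K t s‖ₑ ^ 2 ∂(leb T)) t)
    (setLIntegral_le_lintegral _ _)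

/-- Cauchy–Schwarz again, but the adjoint looks ahead, so only the conditional mean of the squared
path norm appears. -/
lemma enorm_adjOp_sq_le {K : Period T → Period T → ℝ} (hK : Measurable (Function.uncurry K))
    {u : Period T → Ω → ℝ} (hu : ∀ ω, Measurable fun t => u t ω) (t : Period T) (ω : Ω) :
    ‖adjOp P ℱ K u t ω‖ₑ ^ 2 ≤ adjKernelConst K * condNormSq P ℱ u t ω := by
  refine (enorm_integral_mul_sq_le _ (hK.comp measurable_prodMk_right).aemeasurable
    ((measurable_condProc (P := P) (ℱ := ℱ) hu).comp
      (measurable_prodMk_right.prodMk measurable_const)).aemeasurable).trans ?_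
  exact mul_le_mul' (le_iSup (fun t => ∫⁻ s in Ici t, ‖K s t‖ₑ ^ 2 ∂(leb T)) t)
    ((setLIntegral_le_lintegral _ _).trans (lintegral_condProc_sq_le hu t ω))

lemma memLp_two_of_lintegral {X : Type*} [MeasurableSpace X] {ν : Measure X} {f : X → ℝ}
    (hf : Measurable f) (h : ∫⁻ x, ‖f x‖ₑ ^ 2 ∂ν ≠ ∞) : MemLp f 2 ν := by
  refine ⟨hf.aestronglyMeasurable, ?_⟩
  rw [eLpNorm_lt_top_iff_lintegral_rpow_enorm_lt_top (by simp) (by simp)]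
  simpa using h.lt_top

lemma IsGoodKernel.memLp_row {K : Period T → Period T → ℝ} (hK : IsGoodKernel K) (t : Period T) :
    MemLp (K t) 2 ((leb T).restrict (Iic t)) :=
  memLp_two_of_lintegral (hK.meas.comp measurable_prodMk_left)
    ((le_iSup (fun t => ∫⁻ s in Iic t, ‖K t s‖ₑ ^ 2 ∂(leb T)) t).trans_lt hK.const.lt_top).ne

lemma IsGoodKernel.memLp_col {K : Period T → Period T → ℝ} (hK : IsGoodKernel K) (t : Period T) :
    MemLp (fun s => K s t) 2 ((leb T).restrict (Ici t)) :=
  memLp_two_of_lintegral (hK.meas.comp measurable_prodMk_right)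
    ((le_iSup (fun t => ∫⁻ s in Ici t, ‖K s t‖ₑ ^ 2 ∂(leb T)) t).trans_lt hK.adjConst.lt_top).ne

lemma volterra_sub {K : Period T → Period T → ℝ} (hK : IsGoodKernel K) {u v : Period T → Ω → ℝ}
    (hu : IsL2 P ℱ u) (hv : IsL2 P ℱ v) (t : Period T) {ω : Ω} (hω : P {ω} ≠ 0) :
    volterra K (fun t ω => u t ω - v t ω) t ω = volterra K u t ω - volterra K v t ω := by
  have hi : ∀ {w : Period T → Ω → ℝ}, IsL2 P ℱ w →
      Integrable (fun s => K t s * w s ω) ((leb T).restrict (Iic t)) := fun {w} hw =>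
    (hK.memLp_row t).integrable_mul ((memLp_two_of_lintegral (hw.isAdapted.path ω)
      (pathNormSq_ne_top hw.2.ne hω)).restrict _)
  simp only [volterra, mul_sub]
  exact integral_sub (hi hu) (hi hv)

lemma adjOp_sub {K : Period T → Period T → ℝ} (hK : IsGoodKernel K) {u v : Period T → Ω → ℝ}
    (hu : IsL2 P ℱ u) (hv : IsL2 P ℱ v) (t : Period T) (ω : Ω) :
    adjOp P ℱ K (fun t ω => u t ω - v t ω) t ω = adjOp P ℱ K u t ω - adjOp P ℱ K v t ω := by
  have hi : ∀ {w : Period T → Ω → ℝ}, IsL2 P ℱ w →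
      Integrable (fun s => K s t * condProc P ℱ w s t ω) ((leb T).restrict (Ici t)) := fun {w} hw =>
    (hK.memLp_col t).integrable_mul ((memLp_two_of_lintegral
      ((measurable_condProc hw.isAdapted.path).comp
        (measurable_prodMk_right.prodMk measurable_const))
      ((lintegral_condProc_sq_le hw.isAdapted.path t ω).trans_lt
        (condNormSq_ne_top hw.2.ne t ω).lt_top).ne).restrict _)
  simp only [adjOp]
  rw [← integral_sub (hi hu) (hi hv)]
  refine integral_congr_ae (ae_restrict_of_ae ?_)
  filter_upwards [ae_integrable_condMeas hu t ω, ae_integrable_condMeas hv t ω] with s h1 h2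
  simp only [condProc]
  rw [integral_sub h1 h2, mul_sub]

end Operators

/-! ### Lipschitz estimates for the nonlinear Fredholm operator. -/

section Nonlinear

variable {Ω : Type*} [MeasurableSpace Ω] {T : ℝ}

/-- The process `h'(Z^u) u`. -/
def weightedProc (h : ℝ → ℝ) (G : Period T → Period T → ℝ) (g u : Period T → Ω → ℝ)
    (t : Period T) (ω : Ω) : ℝ := deriv h (impactState G g u t ω) * u t ω

/-- The operator `𝐀 + 𝐇 + 𝐇^*`, built from `adjOp`. -/
def fredOp (P : Measure Ω) (ℱ : Filtration (Period T) ‹MeasurableSpace Ω›) (φ ϱ : ℝ) (h : ℝ → ℝ)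
    (G : Period T → Period T → ℝ) (g u : Period T → Ω → ℝ) (t : Period T) (ω : Ω) : ℝ :=
  (h (impactState G g u t ω) + adjOp P ℱ G (weightedProc h G g u) t ω) +
    (volterra (kernelH φ ϱ) u t ω + adjOp P ℱ (kernelH φ ϱ) u t ω)

/-- The assumptions on the impact function `h`, the kernel `G` and the process `g`. -/
structure RegularData (P : Measure Ω) (ℱ : Filtration (Period T) ‹MeasurableSpace Ω›)
    (h : ℝ → ℝ) (G : Period T → Period T → ℝ) (g : Period T → Ω → ℝ) (M L : ℝ≥0) : Prop where
  diff : Differentiable ℝ h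
  bound : ∀ x, ‖deriv h x‖₊ ≤ M
  lip : LipschitzWith L (deriv h)
  kernel : IsGoodKernel G
  state : IsL2 P ℱ g

variable {P : Measure Ω} [IsProbabilityMeasure P] {ℱ : Filtration (Period T) ‹MeasurableSpace Ω›}
  [Countable Ω] [DiscreteMeasurableSpace Ω]
  {h : ℝ → ℝ} {G : Period T → Period T → ℝ} {g : Period T → Ω → ℝ} {M L : ℝ≥0}

lemma isGoodKernel_of_bounded {K : Period T → Period T → ℝ} (hK : Measurable (Function.uncurry K))
    {c : ℝ≥0} (hc : ∀ t s, ‖K t s‖₊ ≤ c) : IsGoodKernel K := by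
  have key : ∀ (f : Period T → ℝ) (A : Set (Period T)), (∀ s, ‖f s‖₊ ≤ c) →
      ∫⁻ s in A, ‖f s‖ₑ ^ 2 ∂(leb T) ≤ c ^ 2 * leb T univ := fun f A hf => by
    refine (setLIntegral_le_lintegral _ _).trans ?_
    rw [← lintegral_const]
    refine lintegral_mono fun s => ?_
    have : ‖f s‖ₑ ≤ c := ENNReal.coe_le_coe.2 (hf s)
    gcongr
  have hfin : (c : ℝ≥0∞) ^ 2 * leb T univ < ∞ :=
    ENNReal.mul_lt_top (by simp) (measure_lt_top _ _)
  exact ⟨hK, ((iSup_le fun t => key _ _ fun s => hc t s).trans_lt hfin).ne,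
    ((iSup_le fun t => key _ _ fun s => hc s t).trans_lt hfin).ne⟩

lemma isGoodKernel_kernelH (φ ϱ : ℝ) : IsGoodKernel (kernelH φ ϱ : Period T → Period T → ℝ) := by
  refine isGoodKernel_of_bounded (c := (‖φ‖₊ * ‖T‖₊ + ‖ϱ‖₊)) ?_ fun t s => ?_
  · refine Measurable.ite (measurableSet_lt measurable_snd measurable_fst) ?_ measurable_const
    exact (Measurable.const_mul (measurable_const.sub measurable_fst.subtype_val) _).add_const _
  · rw [kernelH]
    split_ifs
    · refine (nnnorm_add_le _ _).trans ?_
      rw [nnnorm_mul]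
      gcongr
      rw [← NNReal.coe_le_coe, coe_nnnorm, coe_nnnorm, Real.norm_eq_abs, Real.norm_eq_abs]
      exact abs_le_abs_of_nonneg (by linarith [t.2.2]) (by linarith [t.2.1])
    · simp

lemma RegularData.enorm_deriv_le (hd : RegularData P ℱ h G g M L) (x : ℝ) : ‖deriv h x‖ₑ ≤ M :=
  ENNReal.coe_le_coe.2 (hd.bound x)

lemma RegularData.enorm_sub_le (hd : RegularData P ℱ h G g M L) (x y : ℝ) :
    ‖h x - h y‖ₑ ≤ M * ‖x - y‖ₑ := by
  have := lipschitzWith_of_nnnorm_deriv_le hd.diff hd.bound x y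
  rwa [edist_eq_enorm_sub, edist_eq_enorm_sub] at this

lemma RegularData.enorm_deriv_sub_le (hd : RegularData P ℱ h G g M L) (x y : ℝ) :
    ‖deriv h x - deriv h y‖ₑ ≤ L * ‖x - y‖ₑ := by
  have := hd.lip x y
  rwa [edist_eq_enorm_sub, edist_eq_enorm_sub] at this

lemma RegularData.impactState (hd : RegularData P ℱ h G g M L) {u : Period T → Ω → ℝ}
    (hu : IsAdapted ℱ u) : IsAdapted ℱ (impactState G g u) :=
  hd.state.isAdapted.add (hu.volterra hd.kernel.meas)

lemma RegularData.weightedProc (hd : RegularData P ℱ h G g M L) {u : Period T → Ω → ℝ}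
    (hu : IsAdapted ℱ u) : IsAdapted ℱ (weightedProc h G g u) :=
  ((hd.impactState hu).comp hd.lip.continuous.measurable).mul hu

lemma normSq_le_of_sq_le {u v : Period T → Ω → ℝ} {c : ℝ≥0∞} (hc : c ≠ ∞)
    (huv : ∀ t ω, ‖u t ω‖ₑ ^ 2 ≤ c * ‖v t ω‖ₑ ^ 2) : normSq P u ≤ c * normSq P v := by
  have : ∀ ω, pathNormSq u ω ≤ c * pathNormSq v ω := fun ω => by
    rw [pathNormSq, pathNormSq, ← lintegral_const_mul' _ _ hc]
    exact lintegral_mono fun t => huv t ω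
  rw [normSq, normSq, ← lintegral_const_mul' _ _ hc]
  exact lintegral_mono this

lemma RegularData.isL2_weightedProc (hd : RegularData P ℱ h G g M L) {u : Period T → Ω → ℝ}
    (hu : IsL2 P ℱ u) : IsL2 P ℱ (OptimalTrading.weightedProc h G g u) := by
  rw [isL2_iff] at *
  refine ⟨hd.weightedProc hu.1, (normSq_le_of_sq_le (c := M ^ 2) (by simp)
    fun t ω => ?_).trans_lt (ENNReal.mul_lt_top (by simp) hu.2)⟩
  rw [OptimalTrading.weightedProc, enorm_mul, mul_pow]
  gcongr
  exact hd.enorm_deriv_le _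

lemma IsL2.volterra {K : Period T → Period T → ℝ} (hK : IsGoodKernel K) {u : Period T → Ω → ℝ}
    (hu : IsL2 P ℱ u) : IsL2 P ℱ (volterra K u) := by
  rw [isL2_iff] at *
  refine ⟨hu.1.volterra hK.meas, lt_of_le_of_lt (lintegral_mono fun ω => lintegral_mono fun t =>
    enorm_volterra_sq_le hK.meas (hu.1.path ω) t) ?_⟩
  simp_rw [lintegral_const]
  rw [lintegral_mul_const _ (Measurable.of_discrete), lintegral_const_mul _ (Measurable.of_discrete)]
  exact ENNReal.mul_lt_top (ENNReal.mul_lt_top hK.const.lt_top hu.2) (measure_lt_top _ _)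

lemma IsL2.comp_lipschitz {u : Period T → Ω → ℝ} (hu : IsL2 P ℱ u) {f : ℝ → ℝ} {C : ℝ≥0}
    (hf : LipschitzWith C f) : IsL2 P ℱ fun t ω => f (u t ω) := by
  have h1 : IsL2 P ℱ fun t ω => f (u t ω) - f 0 := by
    rw [isL2_iff] at *
    refine ⟨hu.1.comp (hf.continuous.measurable.sub_const _),
      (normSq_le_of_sq_le (c := C ^ 2) (by simp) fun t ω => ?_).trans_lt
        (ENNReal.mul_lt_top (by simp) hu.2)⟩
    rw [← mul_pow]
    gcongr
    have := hf (u t ω) 0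
    rwa [edist_eq_enorm_sub, edist_eq_enorm_sub, sub_zero] at this
  have h2 : IsL2 P ℱ fun (_ : Period T) (_ : Ω) => f 0 := by
    rw [isL2_iff]
    refine ⟨.det measurable_const, ?_⟩
    simp only [normSq, pathNormSq, lintegral_const, measure_univ, mul_one]
    exact ENNReal.mul_lt_top (by simp) (measure_lt_top _ _)
  simpa using h1.add h2

/-- For fixed `ω` the mass of the atom and the integral over it are both antitone in `t`. -/
lemma measurable_condNormSq (u : Period T → Ω → ℝ) :
    Measurable fun p : Period T × Ω => condNormSq P ℱ u p.1 p.2 := by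
  refine measurable_from_prod_countable_left fun ω => ?_
  simp only [condNormSq, lintegral_condMeas]
  refine Measurable.mul (Measurable.inv ?_) ?_
  · exact (show Antitone fun t => P (atom ℱ t ω) from
      fun s t hst => measure_mono (atom_anti hst ω)).measurable
  · exact (show Antitone fun t => ∫⁻ ω' in atom ℱ t ω, pathNormSq u ω' ∂P from
      fun s t hst => lintegral_mono_set (atom_anti hst ω)).measurable

lemma IsL2.adjOp {K : Period T → Period T → ℝ} (hK : IsGoodKernel K) {u : Period T → Ω → ℝ}
    (hu : IsL2 P ℱ u) : IsL2 P ℱ (adjOp P ℱ K u) := by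
  rw [isL2_iff] at *
  refine ⟨hu.1.adjOp hK.meas, lt_of_le_of_lt (lintegral_mono fun ω => lintegral_mono fun t =>
    enorm_adjOp_sq_le hK.meas hu.1.path t ω) ?_⟩
  simp_rw [lintegral_const_mul' _ _ hK.adjConst]
  refine ENNReal.mul_lt_top hK.adjConst.lt_top ?_
  -- With the expectation inside, the tower property replaces the conditional norm by the norm at
  -- each `t`.
  rw [← lintegral_lintegral_swap (f := fun t ω => condNormSq P ℱ u t ω)
    (measurable_condNormSq u).aemeasurable]
  simp only [condNormSq, lintegral_lintegral_condMeas, lintegral_const]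
  exact ENNReal.mul_lt_top hu.2 (measure_lt_top _ _)

lemma RegularData.lipschitz (hd : RegularData P ℱ h G g M L) : LipschitzWith M h :=
  lipschitzWith_of_nnnorm_deriv_le hd.diff hd.bound

lemma RegularData.isL2_impactState (hd : RegularData P ℱ h G g M L) {u : Period T → Ω → ℝ}
    (hu : IsL2 P ℱ u) : IsL2 P ℱ (OptimalTrading.impactState G g u) :=
  hd.state.add (hu.volterra hd.kernel)

lemma RegularData.isL2_fredOp (hd : RegularData P ℱ h G g M L) (φ ϱ : ℝ) {u : Period T → Ω → ℝ}
    (hu : IsL2 P ℱ u) : IsL2 P ℱ (fredOp P ℱ φ ϱ h G g u) :=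
  (((hd.isL2_impactState hu).comp_lipschitz hd.lipschitz).add
    ((hd.isL2_weightedProc hu).adjOp hd.kernel)).add
    ((hu.volterra (isGoodKernel_kernelH φ ϱ)).add (hu.adjOp (isGoodKernel_kernelH φ ϱ)))

lemma RegularData.impactState_sub (hd : RegularData P ℱ h G g M L) {u v : Period T → Ω → ℝ}
    (hu : IsL2 P ℱ u) (hv : IsL2 P ℱ v) (t : Period T) {ω : Ω} (hω : P {ω} ≠ 0) :
    OptimalTrading.impactState G g u t ω - OptimalTrading.impactState G g v t ω =
      volterra G (fun t ω => u t ω - v t ω) t ω := by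
  rw [volterra_sub hd.kernel hu hv t hω, OptimalTrading.impactState, OptimalTrading.impactState]
  ring

lemma RegularData.enorm_impactState_sub_sq_le (hd : RegularData P ℱ h G g M L)
    {u v : Period T → Ω → ℝ} (hu : IsL2 P ℱ u) (hv : IsL2 P ℱ v) (t : Period T) {ω : Ω}
    (hω : P {ω} ≠ 0) :
    ‖OptimalTrading.impactState G g u t ω - OptimalTrading.impactState G g v t ω‖ₑ ^ 2 ≤
      kernelConst G * pathNormSq (fun t ω => u t ω - v t ω) ω := by
  rw [hd.impactState_sub hu hv t hω]
  exact enorm_volterra_sq_le hd.kernel.meas ((hu.isAdapted.sub hv.isAdapted).path ω) t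

/-- Split the difference as `h'(Z^u)(u - v) + (h'(Z^u) - h'(Z^v))v`. The factor in front of `v` is
bounded uniformly in `t` by the path norm of `u - v`, so only `v` has to lie in the unit ball. -/
lemma RegularData.pathNormSq_weightedProc_sub_le (hd : RegularData P ℱ h G g M L)
    {u v : Period T → Ω → ℝ} (hu : IsL2 P ℱ u) (hv : IsL2 P ℱ v) {ω : Ω} (hω : P {ω} ≠ 0)
    (hv1 : pathNormSq v ω ≤ 1) :
    pathNormSq (fun t ω => OptimalTrading.weightedProc h G g u t ω
        - OptimalTrading.weightedProc h G g v t ω) ω ≤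
      2 * (M ^ 2 + L ^ 2 * kernelConst G) * pathNormSq (fun t ω => u t ω - v t ω) ω := by
  set w : Period T → Ω → ℝ := fun t ω => u t ω - v t ω
  have hw := hu.sub hv
  have hwfin : pathNormSq w ω ≠ ∞ := pathNormSq_ne_top hw.2.ne hω
  have key : ∀ t, ‖OptimalTrading.weightedProc h G g u t ω
      - OptimalTrading.weightedProc h G g v t ω‖ₑ ^ 2 ≤
      2 * (M ^ 2 * ‖w t ω‖ₑ ^ 2 + L ^ 2 * (kernelConst G * pathNormSq w ω) * ‖v t ω‖ₑ ^ 2) := by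
    intro t
    have e : OptimalTrading.weightedProc h G g u t ω - OptimalTrading.weightedProc h G g v t ω =
        deriv h (OptimalTrading.impactState G g u t ω) * w t ω +
        (deriv h (OptimalTrading.impactState G g u t ω)
          - deriv h (OptimalTrading.impactState G g v t ω)) * v t ω := by
      simp only [OptimalTrading.weightedProc, w]
      ring
    rw [e]
    refine (enorm_add_sq_le _ _).trans ?_
    rw [enorm_mul, enorm_mul, mul_pow, mul_pow]
    gcongr
    · exact hd.enorm_deriv_le _
    · calc _ ≤ (L * ‖OptimalTrading.impactState G g u t ω
              - OptimalTrading.impactState G g v t ω‖ₑ) ^ 2 := by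
            gcongr
            exact hd.enorm_deriv_sub_le _ _
        _ ≤ _ := by
            rw [mul_pow]
            gcongr
            exact hd.enorm_impactState_sub_sq_le hu hv t hω
  refine (lintegral_mono key).trans ?_
  have hc : (L : ℝ≥0∞) ^ 2 * (kernelConst G * pathNormSq w ω) ≠ ∞ :=
    ENNReal.mul_ne_top (by simp) (ENNReal.mul_ne_top hd.kernel.const hwfin)
  rw [lintegral_const_mul' _ _ (by simp), lintegral_add_left
    (((hw.isAdapted.path ω).enorm.pow_const 2).const_mul _),
    lintegral_const_mul' _ _ (by simp), lintegral_const_mul' _ _ hc,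
    mul_assoc 2, add_mul, mul_assoc _ (kernelConst G)]
  exact mul_le_mul_right (add_le_add le_rfl (mul_le_of_le_one_right' hv1)) 2

/-- The Lipschitz constant of `fredOp` around the unit ball. -/
def lipConst (φ ϱ : ℝ) (G : Period T → Period T → ℝ) (M L : ℝ≥0) : ℝ≥0∞ :=
  2 * (2 * (M ^ 2 * kernelConst G + adjKernelConst G * (2 * (M ^ 2 + L ^ 2 * kernelConst G)))
    + 2 * (kernelConst (kernelH φ ϱ : Period T → Period T → ℝ)
      + adjKernelConst (kernelH φ ϱ : Period T → Period T → ℝ)))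

lemma lipConst_ne_top (φ ϱ : ℝ) (hG : IsGoodKernel G) : lipConst φ ϱ G M L ≠ ∞ := by
  have h1 := hG.const
  have h2 := hG.adjConst
  have h3 := (isGoodKernel_kernelH (T := T) φ ϱ).const
  have h4 := (isGoodKernel_kernelH (T := T) φ ϱ).adjConst
  simp only [lipConst]
  finiteness

/-- The two forward terms cost the path norm of `u - v`, the two adjoint terms its conditional mean.
Keeping these apart allows both an `𝓛²` bound and a pathwise bound. -/
lemma RegularData.enorm_fredOp_sub_sq_le (hd : RegularData P ℱ h G g M L) (φ ϱ : ℝ)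
    {u v : Period T → Ω → ℝ} (hu : IsL2 P ℱ u) (hv : IsL2 P ℱ v)
    (hv1 : ∀ ω, P {ω} ≠ 0 → pathNormSq v ω ≤ 1) (t : Period T) {ω : Ω} (hω : P {ω} ≠ 0) :
    ‖fredOp P ℱ φ ϱ h G g u t ω - fredOp P ℱ φ ϱ h G g v t ω‖ₑ ^ 2 ≤
      lipConst φ ϱ G M L * (pathNormSq (fun t ω => u t ω - v t ω) ω
        + condNormSq P ℱ (fun t ω => u t ω - v t ω) t ω) := by
  have hH := isGoodKernel_kernelH (T := T) φ ϱ
  have hw := hu.sub hv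
  have hq := hd.isL2_weightedProc hu
  have hq' := hd.isL2_weightedProc hv
  set w : Period T → Ω → ℝ := fun t ω => u t ω - v t ω
  have e : fredOp P ℱ φ ϱ h G g u t ω - fredOp P ℱ φ ϱ h G g v t ω =
      ((h (OptimalTrading.impactState G g u t ω) - h (OptimalTrading.impactState G g v t ω))
        + OptimalTrading.adjOp P ℱ G (fun t ω => OptimalTrading.weightedProc h G g u t ω
          - OptimalTrading.weightedProc h G g v t ω) t ω)
      + (volterra (kernelH φ ϱ) w t ω + OptimalTrading.adjOp P ℱ (kernelH φ ϱ) w t ω) := by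
    rw [adjOp_sub hd.kernel hq hq', volterra_sub hH hu hv t hω, adjOp_sub hH hu hv, fredOp, fredOp]
    ring
  rw [e]
  have b1 : ‖h (OptimalTrading.impactState G g u t ω)
      - h (OptimalTrading.impactState G g v t ω)‖ₑ ^ 2 ≤
      M ^ 2 * (kernelConst G * pathNormSq w ω) := by
    calc _ ≤ (M * ‖OptimalTrading.impactState G g u t ω
              - OptimalTrading.impactState G g v t ω‖ₑ) ^ 2 := by
            gcongr
            exact hd.enorm_sub_le _ _
      _ ≤ _ := by
            rw [mul_pow]
            gcongr
            exact hd.enorm_impactState_sub_sq_le hu hv t hω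
  have b2 := enorm_adjOp_sq_le (P := P) (ℱ := ℱ) hd.kernel.meas
    (hq.isAdapted.sub hq'.isAdapted).path t ω
  have b2' : condNormSq P ℱ (fun t ω => OptimalTrading.weightedProc h G g u t ω
          - OptimalTrading.weightedProc h G g v t ω) t ω ≤
      2 * (M ^ 2 + L ^ 2 * kernelConst G) * condNormSq P ℱ w t ω := by
    rw [condNormSq, condNormSq, ← lintegral_const_mul _ Measurable.of_discrete]
    exact lintegral_mono_ae (ae_condMeas_of_forall fun ω' hω' =>
      hd.pathNormSq_weightedProc_sub_le hu hv hω' (hv1 ω' hω'))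
  have b3 := enorm_volterra_sq_le hH.meas (hw.isAdapted.path ω) t
  have b4 := enorm_adjOp_sq_le (P := P) (ℱ := ℱ) hH.meas hw.isAdapted.path t ω
  set a := pathNormSq w ω
  set b := condNormSq P ℱ w t ω
  refine (enorm_add_sq_le _ _).trans ?_
  have ha : a ≤ a + b := le_self_add
  have hb : b ≤ a + b := le_add_self
  have c1 := (enorm_add_sq_le (h (OptimalTrading.impactState G g u t ω)
      - h (OptimalTrading.impactState G g v t ω)) _).trans
    (mul_le_mul_right (add_le_add (b1.trans (mul_le_mul_right (mul_le_mul_right ha _) _))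
      (b2.trans (mul_le_mul_right (b2'.trans (mul_le_mul_right hb _)) _))) 2)
  have c2 := (enorm_add_sq_le (volterra (kernelH φ ϱ) w t ω) _).trans
    (mul_le_mul_right (add_le_add (b3.trans (mul_le_mul_right ha _))
      (b4.trans (mul_le_mul_right hb _))) 2)
  refine (mul_le_mul_right (add_le_add c1 c2) 2).trans_eq ?_
  rw [lipConst]
  ring

/-- In expectation the conditional norm equals the norm by the tower property, so each of the two
terms contributes one factor `leb T univ`. -/
lemma RegularData.normSq_fredOp_sub_le (hd : RegularData P ℱ h G g M L) (φ ϱ : ℝ)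
    {u v : Period T → Ω → ℝ} (hu : IsL2 P ℱ u) (hv : IsL2 P ℱ v)
    (hv1 : ∀ ω, P {ω} ≠ 0 → pathNormSq v ω ≤ 1) :
    normSq P (fun t ω => fredOp P ℱ φ ϱ h G g u t ω - fredOp P ℱ φ ϱ h G g v t ω) ≤
      lipConst φ ϱ G M L * (2 * leb T univ) * normSq P (fun t ω => u t ω - v t ω) := by
  have hB := lipConst_ne_top (M := M) (L := L) φ ϱ hd.kernel
  set B := lipConst φ ϱ G M L
  set w : Period T → Ω → ℝ := fun t ω => u t ω - v t ω
  have h1 : normSq P (fun t ω => fredOp P ℱ φ ϱ h G g u t ω - fredOp P ℱ φ ϱ h G g v t ω) ≤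
      ∫⁻ ω, ∫⁻ t, B * (pathNormSq w ω + condNormSq P ℱ w t ω) ∂(leb T) ∂P :=
    lintegral_mono_ae (ae_iff_of_countable.2 fun ω hω => lintegral_mono fun t =>
      hd.enorm_fredOp_sub_sq_le φ ϱ hu hv hv1 t hω)
  refine h1.trans_eq ?_
  simp_rw [lintegral_const_mul' _ _ hB, lintegral_add_left measurable_const, lintegral_const]
  rw [lintegral_add_left Measurable.of_discrete, lintegral_mul_const _ Measurable.of_discrete,
    ← lintegral_lintegral_swap (f := fun t ω => condNormSq P ℱ w t ω)
      (measurable_condNormSq w).aemeasurable]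
  simp only [condNormSq, lintegral_lintegral_condMeas, lintegral_const, normSq]
  ring

/-- A uniform pathwise bound survives conditioning. This version serves to show that the unit ball
is mapped into itself. -/
lemma RegularData.pathNormSq_fredOp_sub_le (hd : RegularData P ℱ h G g M L) (φ ϱ : ℝ)
    {u v : Period T → Ω → ℝ} (hu : IsL2 P ℱ u) (hv : IsL2 P ℱ v)
    (hv1 : ∀ ω, P {ω} ≠ 0 → pathNormSq v ω ≤ 1) {c : ℝ≥0∞}
    (hc : ∀ ω, P {ω} ≠ 0 → pathNormSq (fun t ω => u t ω - v t ω) ω ≤ c) {ω : Ω} (hω : P {ω} ≠ 0) :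
    pathNormSq (fun t ω => fredOp P ℱ φ ϱ h G g u t ω - fredOp P ℱ φ ϱ h G g v t ω) ω ≤
      lipConst φ ϱ G M L * (2 * leb T univ) * c := by
  have h1 : ∀ t, ‖fredOp P ℱ φ ϱ h G g u t ω - fredOp P ℱ φ ϱ h G g v t ω‖ₑ ^ 2 ≤
      lipConst φ ϱ G M L * (c + c) := fun t => by
    refine (hd.enorm_fredOp_sub_sq_le φ ϱ hu hv hv1 t hω).trans ?_
    gcongr
    · exact hc ω hω
    · refine (lintegral_mono_ae (ae_condMeas_of_forall hc)).trans ?_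
      rw [lintegral_const]
      exact mul_le_of_le_one_right' (condMeas_univ_le t ω)
  refine (lintegral_mono h1).trans_eq ?_
  rw [lintegral_const]
  ring

lemma fredOp_zero (φ ϱ : ℝ) (t : Period T) (ω : Ω) :
    fredOp P ℱ φ ϱ h G g (fun _ _ => 0) t ω = h (g t ω) := by
  simp [fredOp, adjOp, volterra, condProc, weightedProc, impactState]

end Nonlinear

/-! ### Contraction in the unit ball and solution of the Fredholm equation. -/

section FixedPoint

open Filter Topology

variable {Ω : Type*} [MeasurableSpace Ω] {T : ℝ}
  {P : Measure Ω} [IsProbabilityMeasure P] {ℱ : Filtration (Period T) ‹MeasurableSpace Ω›}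
  [Countable Ω] [DiscreteMeasurableSpace Ω]

lemma eLpNorm_two_sq {X : Type*} [MeasurableSpace X] (ν : Measure X) (f : X → ℝ) :
    eLpNorm f 2 ν ^ 2 = ∫⁻ x, ‖f x‖ₑ ^ 2 ∂ν := by
  have := eLpNorm_nnreal_pow_eq_lintegral (μ := ν) (f := f) (p := 2) (by norm_num)
  simpa using this

lemma lintegral_uncurry_eq_normSq {u : Period T → Ω → ℝ} (hu : IsAdapted ℱ u) :
    ∫⁻ p, ‖u p.1 p.2‖ₑ ^ 2 ∂((leb T).prod P) = normSq P u :=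
  lintegral_prod_symm _ (hu.measurable_uncurry.enorm.pow_const 2).aemeasurable

lemma ae_eq_of_normSq_sub_eq_zero {u v : Period T → Ω → ℝ} (hu : IsAdapted ℱ u)
    (hv : IsAdapted ℱ v) (h : normSq P (fun t ω => u t ω - v t ω) = 0) :
    ∀ ω, P {ω} ≠ 0 → ∀ᵐ t ∂(leb T), u t ω = v t ω := by
  intro ω hω
  have h1 := (lintegral_eq_zero_iff (measurable_pathNormSq_of_discrete _)).1 h
  have h2 := ae_iff_of_countable.1 h1 ω hω
  have h3 := (lintegral_eq_zero_iff (((hu.path ω).sub (hv.path ω)).enorm.pow_const 2)).1 h2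
  filter_upwards [h3] with t ht
  simpa [sub_eq_zero] using ht

lemma normSq_congr {u v : Period T → Ω → ℝ}
    (h : ∀ ω, P {ω} ≠ 0 → ∀ᵐ t ∂(leb T), u t ω = v t ω) : normSq P u = normSq P v :=
  lintegral_congr_ae (ae_iff_of_countable.2 fun ω hω => lintegral_congr_ae (by
    filter_upwards [h ω hω] with t ht
    rw [ht]))

lemma normSq_sub_comm (u v : Period T → Ω → ℝ) :
    normSq P (fun t ω => u t ω - v t ω) = normSq P (fun t ω => v t ω - u t ω) := by
  simp only [normSq, pathNormSq, enorm_sub_rev]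

/-- The adapted elements of the closed unit ball of `𝓛^∞(Ω, L²)`. -/
structure InBall (P : Measure Ω) (ℱ : Filtration (Period T) ‹MeasurableSpace Ω›)
    (u : Period T → Ω → ℝ) : Prop where
  adapted : IsAdapted ℱ u
  le_one : ∀ ω, P {ω} ≠ 0 → pathNormSq u ω ≤ 1

lemma InBall.normSq_le {u : Period T → Ω → ℝ} (hu : InBall P ℱ u) : normSq P u ≤ 1 := by
  refine (lintegral_mono_ae (ae_iff_of_countable.2 hu.le_one)).trans_eq ?_
  simp

lemma InBall.isL2 {u : Period T → Ω → ℝ} (hu : InBall P ℱ u) : IsL2 P ℱ u :=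
  isL2_iff.2 ⟨hu.adapted, hu.normSq_le.trans_lt ENNReal.one_lt_top⟩

/-- A pointwise `limsup` is defined everywhere, so it stays Borel in time and constant on atoms even
where convergence fails. Fatou's lemma on each path preserves the bound. -/
lemma inBall_limsup {U : ℕ → Period T → Ω → ℝ} (hU : ∀ n, InBall P ℱ (U n))
    (hlim : ∀ ω, P {ω} ≠ 0 → ∀ᵐ t ∂(leb T), ∃ l, Tendsto (fun n => U n t ω) atTop (𝓝 l)) :
    InBall P ℱ fun t ω => limsup (fun n => U n t ω) atTop := by
  refine ⟨⟨fun ω => Measurable.limsup fun n => (hU n).adapted.path ω, fun t ω ω' h => ?_⟩,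
    fun ω hω => ?_⟩
  · simp only [fun n => (hU n).adapted.const t ω ω' h]
  · have h1 : pathNormSq (fun t ω => limsup (fun n => U n t ω) atTop) ω =
        ∫⁻ t, liminf (fun n => ‖U n t ω‖ₑ ^ 2) atTop ∂(leb T) := by
      refine lintegral_congr_ae ?_
      filter_upwards [hlim ω hω] with t ⟨l, hl⟩
      have h2 : Tendsto (fun n => ‖U n t ω‖ₑ ^ 2) atTop (𝓝 (‖l‖ₑ ^ 2)) :=
        ((ENNReal.continuous_pow 2).comp continuous_enorm).continuousAt.tendsto.comp hl
      rw [hl.limsup_eq, h2.liminf_eq]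
    rw [h1]
    refine (lintegral_liminf_le fun n => ((hU n).adapted.path ω).enorm.pow_const 2).trans ?_
    exact liminf_le_of_frequently_le' (Frequently.of_forall fun n => (hU n).le_one ω hω)

/-- Banach's iteration from `0`. Distances are measured in `𝓛²` while the iterates stay in the
pathwise ball, which is closed under the almost-everywhere limits that arise. -/
lemma exists_fixedPoint {Φ : (Period T → Ω → ℝ) → Period T → Ω → ℝ}
    (hmap : ∀ u, InBall P ℱ u → InBall P ℱ (Φ u))
    (hcontr : ∀ u v, InBall P ℱ u → InBall P ℱ v →
      4 * normSq P (fun t ω => Φ u t ω - Φ v t ω) ≤ normSq P (fun t ω => u t ω - v t ω)) :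
    ∃ û, InBall P ℱ û ∧ ∀ ω, P {ω} ≠ 0 → ∀ᵐ t ∂(leb T), û t ω = Φ û t ω := by
  set U : ℕ → Period T → Ω → ℝ := fun n => Φ^[n] fun _ _ => 0
  have hU_succ : ∀ n, U (n + 1) = Φ (U n) := fun n => Function.iterate_succ_apply' _ _ _
  have hU : ∀ n, InBall P ℱ (U n) := by
    intro n
    induction n with
    | zero => exact ⟨.det measurable_const, fun ω _ => by simp [U, pathNormSq]⟩
    | succ n ih => rw [hU_succ]; exact hmap _ ih
  -- The bound `4 = 2 * (1 + 1)` is for the squared distance of two points of the ball; each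
  -- iteration gains a factor `4`.
  have hcau : ∀ N n m : ℕ, N ≤ n → N ≤ m →
      4 ^ N * normSq P (fun t ω => U n t ω - U m t ω) ≤ 4 := by
    intro N
    induction N with
    | zero =>
      intro n m _ _
      rw [pow_zero, one_mul]
      refine (normSq_sub_le (hU n).adapted).trans ?_
      calc _ ≤ (2 : ℝ≥0∞) * (1 + 1) :=
            mul_le_mul_right (add_le_add (hU n).normSq_le (hU m).normSq_le) 2
        _ = 4 := by norm_num
    | succ N ih =>
      intro n m hn hm
      obtain ⟨n, rfl⟩ : ∃ k, n = k + 1 := ⟨n - 1, by omega⟩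
      obtain ⟨m, rfl⟩ : ∃ k, m = k + 1 := ⟨m - 1, by omega⟩
      rw [pow_succ, mul_assoc, hU_succ, hU_succ]
      exact (mul_le_mul_right (hcontr _ _ (hU n) (hU m)) _).trans
        (ih n m (by omega) (by omega))
  set f : ℕ → Period T × Ω → ℝ := fun n p => U n p.1 p.2
  have hf : ∀ n, AEStronglyMeasurable (f n) ((leb T).prod P) := fun n =>
    (hU n).adapted.measurable_uncurry.aestronglyMeasurable
  have hsq : ∀ {u v : Period T → Ω → ℝ}, IsAdapted ℱ u → IsAdapted ℱ v →
      eLpNorm ((fun p : Period T × Ω => u p.1 p.2) - fun p => v p.1 p.2) 2 ((leb T).prod P) ^ 2 =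
        normSq P (fun t ω => u t ω - v t ω) := fun hu hv => by
    rw [eLpNorm_two_sq, ← lintegral_uncurry_eq_normSq (hu.sub hv)]
    rfl
  have hB : ∑' n : ℕ, (3 * (2 : ℝ≥0∞)⁻¹ ^ n) ≠ ∞ := by
    rw [ENNReal.tsum_mul_left, ENNReal.tsum_geometric_two]
    exact ENNReal.mul_ne_top (by simp) (by simp)
  -- Taking roots gives `2 * 2⁻ᴺ`; the constant `3` makes the inequality strict, as the summable
  -- Cauchy criterion requires.
  have hcau' : ∀ N n m : ℕ, N ≤ n → N ≤ m →
      eLpNorm (f n - f m) 2 ((leb T).prod P) < 3 * (2 : ℝ≥0∞)⁻¹ ^ N := by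
    intro N n m hn hm
    have h1 : (2 ^ N * eLpNorm (f n - f m) 2 ((leb T).prod P)) ^ 2 < 3 ^ 2 := by
      rw [mul_pow, hsq (hU n).adapted (hU m).adapted, ← pow_mul, mul_comm N, pow_mul,
        show (2 : ℝ≥0∞) ^ 2 = 4 by norm_num]
      exact (hcau N n m hn hm).trans_lt (by norm_num)
    have h2 := lt_of_not_ge fun hge => h1.not_ge (pow_le_pow_left₀ zero_le hge 2)
    rw [← ENNReal.inv_pow, ← div_eq_mul_inv, ENNReal.lt_div_iff_mul_lt (Or.inl (by simp))
      (Or.inl (by simp)), mul_comm]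
    exact h2
  have hlim : ∀ᵐ p ∂((leb T).prod P), ∃ l, Tendsto (fun n => f n p) atTop (𝓝 l) :=
    Lp.ae_tendsto_of_cauchy_eLpNorm hf (by norm_num) hB hcau'
  have hlim' := ae_prod_iff_of_countable (p := fun t ω => ∃ l, Tendsto (fun n => U n t ω) atTop (𝓝 l)).1
    hlim
  set û : Period T → Ω → ℝ := fun t ω => limsup (fun n => U n t ω) atTop
  have hû : InBall P ℱ û := inBall_limsup hU hlim'
  refine ⟨û, hû, ?_⟩
  have htend : Tendsto (fun n => normSq P (fun t ω => U n t ω - û t ω)) atTop (𝓝 0) := by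
    have h1 : Tendsto (fun n => eLpNorm (f n - fun p => û p.1 p.2) 2 ((leb T).prod P))
        atTop (𝓝 0) := by
      refine Lp.cauchy_tendsto_of_tendsto hf _ hB hcau' ?_
      filter_upwards [hlim] with p ⟨l, hl⟩
      have : û p.1 p.2 = l := hl.limsup_eq
      rwa [this]
    have h2 := ((ENNReal.continuous_pow 2).tendsto 0).comp h1
    rw [zero_pow two_ne_zero] at h2
    exact h2.congr fun n => hsq (hU n).adapted hû.adapted
  refine ae_eq_of_normSq_sub_eq_zero hû.adapted (hmap _ hû).adapted ?_
  -- Insert `U (n + 1) = Φ (U n)` between `û` and `Φ û`.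
  have hle : ∀ n, normSq P (fun t ω => û t ω - Φ û t ω) ≤
      2 * (normSq P (fun t ω => U (n + 1) t ω - û t ω) + normSq P (fun t ω => U n t ω - û t ω)) := by
    intro n
    have h1 := normSq_add_le (P := P) (v := fun t ω => U (n + 1) t ω - Φ û t ω)
      (hû.adapted.sub (hU (n + 1)).adapted)
    simp only [sub_add_sub_cancel] at h1
    refine h1.trans (mul_le_mul_right (add_le_add (normSq_sub_comm _ _).le ?_) 2)
    rw [hU_succ]
    exact le_trans (le_mul_of_one_le_left' (by norm_num)) (hcontr _ _ (hU n) hû)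
  have h3 : Tendsto (fun n => 2 * (normSq P (fun t ω => U (n + 1) t ω - û t ω)
      + normSq P (fun t ω => U n t ω - û t ω))) atTop (𝓝 0) := by
    have := ENNReal.Tendsto.const_mul (a := 2)
      ((htend.comp (tendsto_add_atTop_nat 1)).add htend) (Or.inr (by simp))
    simpa using this
  exact le_antisymm (ge_of_tendsto' h3 hle) zero_le

/-- A finite `n` with `4 * n ≤ n` is zero. The contraction is required for this one pair only, so a
fixed point outside the ball can be compared with one inside. -/
lemma ae_eq_of_fixedPoints {Φ : (Period T → Ω → ℝ) → Period T → Ω → ℝ} {u v : Period T → Ω → ℝ}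
    (hu : IsL2 P ℱ u) (hv : IsL2 P ℱ v)
    (hcontr : 4 * normSq P (fun t ω => Φ u t ω - Φ v t ω) ≤ normSq P (fun t ω => u t ω - v t ω))
    (hΦu : ∀ ω, P {ω} ≠ 0 → ∀ᵐ t ∂(leb T), u t ω = Φ u t ω)
    (hΦv : ∀ ω, P {ω} ≠ 0 → ∀ᵐ t ∂(leb T), v t ω = Φ v t ω) :
    ∀ ω, P {ω} ≠ 0 → ∀ᵐ t ∂(leb T), u t ω = v t ω := by
  refine ae_eq_of_normSq_sub_eq_zero hu.isAdapted hv.isAdapted ?_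
  rw [← normSq_congr (u := fun t ω => u t ω - v t ω) fun ω hω => by
    filter_upwards [hΦu ω hω, hΦv ω hω] with t h1 h2
    rw [← h1, ← h2]] at hcontr
  have hfin : normSq P (fun t ω => u t ω - v t ω) ≠ ∞ := (isL2_iff.1 (hu.sub hv)).2.ne
  by_contra h0
  have := (ENNReal.mul_le_mul_iff_left (a := 4) (b := 1) h0 hfin).1 (by rwa [one_mul])
  norm_num at this

/-- If `γ ≥ 1 + E` then `γ² ≥ γ ≥ E`. -/
lemma exists_gamma {E : ℝ≥0∞} (hE : E ≠ ∞) :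
    ∃ γ₁ : ℝ, 0 < γ₁ ∧ ∀ γ, γ₁ ≤ γ → ‖γ⁻¹‖ₑ ^ 2 * E ≤ 1 := by
  refine ⟨1 + E.toReal, by positivity, fun γ hγ => ?_⟩
  have h0 := E.toReal_nonneg
  have hγ1 : 1 ≤ γ := by linarith
  rw [enorm_sq_eq, ← ENNReal.ofReal_toReal hE, ← ENNReal.ofReal_mul (sq_nonneg _),
    ENNReal.ofReal_le_one, inv_pow, inv_mul_le_iff₀ (by positivity)]
  nlinarith

/-- The map `u ↦ γ⁻¹ (F - 𝐀(u) - 𝐇u - 𝐇^*u)`. -/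
def fixMap (P : Measure Ω) (ℱ : Filtration (Period T) ‹MeasurableSpace Ω›) (φ ϱ γ : ℝ) (h : ℝ → ℝ)
    (G : Period T → Period T → ℝ) (g F u : Period T → Ω → ℝ) (t : Period T) (ω : Ω) : ℝ :=
  γ⁻¹ * (F t ω - fredOp P ℱ φ ϱ h G g u t ω)

variable {h : ℝ → ℝ} {G : Period T → Period T → ℝ} {g F : Period T → Ω → ℝ} {M L : ℝ≥0}

lemma pathNormSq_const_mul (c : ℝ) (u : Period T → Ω → ℝ) (ω : Ω) :
    pathNormSq (fun t ω => c * u t ω) ω = ‖c‖ₑ ^ 2 * pathNormSq u ω := by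
  simp only [pathNormSq, enorm_mul, mul_pow]
  exact lintegral_const_mul' _ _ (by simp)

lemma normSq_const_mul (c : ℝ) (u : Period T → Ω → ℝ) :
    normSq P (fun t ω => c * u t ω) = ‖c‖ₑ ^ 2 * normSq P u := by
  simp only [normSq, pathNormSq_const_mul]
  exact lintegral_const_mul' _ _ (by simp)

/-- The threshold for `γ²` above which `fixMap` is a contraction of the unit ball. -/
def contractConst (φ ϱ : ℝ) (G : Period T → Period T → ℝ) (M L : ℝ≥0) (K : ℝ≥0∞) : ℝ≥0∞ :=
  4 * (lipConst φ ϱ G M L * (2 * leb T univ)) + 2 * K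

/-- The asymmetry between `u` in `𝓛²` and `v` in the ball is what extends uniqueness from the ball
to all of `𝓛²`. -/
lemma RegularData.normSq_fixMap_sub_le (hd : RegularData P ℱ h G g M L) (φ ϱ : ℝ) {γ : ℝ}
    {K : ℝ≥0∞} (hγ : ‖γ⁻¹‖ₑ ^ 2 * contractConst φ ϱ G M L K ≤ 1) {u v : Period T → Ω → ℝ}
    (hu : IsL2 P ℱ u) (hv : InBall P ℱ v) :
    4 * normSq P (fun t ω => fixMap P ℱ φ ϱ γ h G g F u t ω - fixMap P ℱ φ ϱ γ h G g F v t ω) ≤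
      normSq P (fun t ω => u t ω - v t ω) := by
  have e : (fun t ω => fixMap P ℱ φ ϱ γ h G g F u t ω - fixMap P ℱ φ ϱ γ h G g F v t ω) =
      fun t ω => (-γ⁻¹) * (fredOp P ℱ φ ϱ h G g u t ω - fredOp P ℱ φ ϱ h G g v t ω) := by
    funext t ω
    simp only [fixMap]
    ring
  rw [e, normSq_const_mul (-γ⁻¹)
    (fun t ω => fredOp P ℱ φ ϱ h G g u t ω - fredOp P ℱ φ ϱ h G g v t ω), enorm_neg]
  calc _ ≤ 4 * (‖γ⁻¹‖ₑ ^ 2 * (lipConst φ ϱ G M L * (2 * leb T univ)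
          * normSq P (fun t ω => u t ω - v t ω))) := by
        gcongr
        exact hd.normSq_fredOp_sub_le φ ϱ hu hv.isL2 hv.le_one
    _ = ‖γ⁻¹‖ₑ ^ 2 * (4 * (lipConst φ ϱ G M L * (2 * leb T univ)))
          * normSq P (fun t ω => u t ω - v t ω) := by ring
    _ ≤ 1 * normSq P (fun t ω => u t ω - v t ω) := by
        gcongr
        exact (mul_le_mul_right le_self_add _).trans hγ
    _ = _ := one_mul _

lemma RegularData.inBall_fixMap (hd : RegularData P ℱ h G g M L) (φ ϱ : ℝ) {γ : ℝ}
    {K : ℝ≥0∞} (hγ : ‖γ⁻¹‖ₑ ^ 2 * contractConst φ ϱ G M L K ≤ 1) (hF : IsL2 P ℱ F)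
    (hK : ∀ ω, P {ω} ≠ 0 → pathNormSq (fun t ω => F t ω - h (g t ω)) ω ≤ K)
    {u : Period T → Ω → ℝ} (hu : InBall P ℱ u) : InBall P ℱ (fixMap P ℱ φ ϱ γ h G g F u) := by
  have hfu := (hd.isL2_fredOp φ ϱ hu.isL2).isAdapted
  have h0 : InBall P ℱ (fun (_ : Period T) (_ : Ω) => (0 : ℝ)) :=
    ⟨.det measurable_const, fun ω _ => by simp [pathNormSq]⟩
  refine ⟨(hF.isAdapted.sub hfu).comp (measurable_const_mul γ⁻¹), fun ω hω => ?_⟩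
  have h1 := hd.pathNormSq_fredOp_sub_le φ ϱ hu.isL2 h0.isL2 h0.le_one (c := 1)
    (by simpa only [sub_zero] using hu.le_one) hω
  simp only [fredOp_zero, mul_one] at h1
  -- Centre at the value `h(g)` of the operator at `u = 0`: the first bracket is bounded by `K`, the
  -- second by the Lipschitz estimate between `u` and `0`.
  have e : fixMap P ℱ φ ϱ γ h G g F u = fun t ω => γ⁻¹ * ((F t ω - h (g t ω))
      - (fredOp P ℱ φ ϱ h G g u t ω - h (g t ω))) := by
    funext t ω
    simp only [fixMap]
    ring
  rw [e, pathNormSq_const_mul γ⁻¹ (fun t ω => (F t ω - h (g t ω))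
      - (fredOp P ℱ φ ϱ h G g u t ω - h (g t ω)))]
  refine le_trans ?_ hγ
  gcongr
  refine (pathNormSq_sub_le (u := fun t ω => F t ω - h (g t ω))
    ((hF.isAdapted.sub (hd.state.isAdapted.comp hd.diff.continuous.measurable)).path ω)).trans ?_
  rw [contractConst]
  calc _ ≤ 2 * (K + lipConst φ ϱ G M L * (2 * leb T univ)) := by gcongr; exact hK ω hω
    _ = 2 * (lipConst φ ϱ G M L * (2 * leb T univ)) + 2 * K := by ring
    _ ≤ _ := by gcongr; norm_num

lemma contractConst_ne_top (φ ϱ : ℝ) (hG : IsGoodKernel G) {K : ℝ≥0∞} (hK : K ≠ ∞) :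
    contractConst φ ϱ G M L K ≠ ∞ := by
  have := lipConst_ne_top (M := M) (L := L) φ ϱ hG
  have := measure_ne_top (leb T) univ
  simp only [contractConst]
  finiteness

lemma solvesFredholm_iff (hd : RegularData P ℱ h G g M L) {X₀ φ ϱ γ : ℝ} (hγ : γ ≠ 0)
    {α u : Period T → Ω → ℝ} (hu : IsL2 P ℱ u) :
    SolvesFredholm P ℱ X₀ φ ϱ γ h G g α u ↔ ∀ ω, P {ω} ≠ 0 → ∀ᵐ t ∂(leb T), u t ω =
      fixMap P ℱ φ ϱ γ h G g (fun t ω => α t ω - X₀ * (φ * (T - t) + ϱ)) u t ω := by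
  rw [SolvesFredholm, AEEq, ae_prod_iff_of_countable
    (p := fun t ω => γ * u t ω + opA P ℱ h G g u t ω + volterra (kernelH φ ϱ) u t ω
      + volterraAdj P ℱ (kernelH φ ϱ) u t ω = α t ω - X₀ * (φ * (T - t) + ϱ))]
  refine forall₂_congr fun ω hω => eventually_congr (Eventually.of_forall fun t => ?_)
  rw [opA, volterraAdj_eq_adjOp hu _ _ hω,
    volterraAdj_eq_adjOp (u := fun s ω' => deriv h (impactState G g u s ω') * u s ω')
      (hd.isL2_weightedProc hu) _ _ hω, fixMap, fredOp, eq_inv_mul_iff_mul_eq₀ hγ]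
  change γ * u t ω + (_ + adjOp P ℱ G (weightedProc h G g u) t ω) + _ + _ = _ ↔ _
  constructor <;> intro H <;> linarith

lemma IsLinfL2.exists_bound {u : Period T → Ω → ℝ} (hu : IsLinfL2 P ℱ u) :
    ∃ c : ℝ≥0∞, c ≠ ∞ ∧ ∀ ω, P {ω} ≠ 0 → pathNormSq u ω ≤ c := by
  refine ⟨_, ENNReal.pow_ne_top (n := 2) hu.2.ne, fun ω hω => ?_⟩
  have := ae_iff_of_countable.1
    (ENNReal.ae_le_essSup (μ := P) fun ω => eLpNorm (fun t => u t ω) 2 (leb T)) ω hω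
  rw [pathNormSq, ← eLpNorm_two_sq]
  gcongr

lemma IsLinfL2.isL2 {u : Period T → Ω → ℝ} (hu : IsLinfL2 P ℱ u) : IsL2 P ℱ u := by
  obtain ⟨c, hc, h⟩ := hu.exists_bound
  refine ⟨hu.1, (lintegral_mono_ae (ae_iff_of_countable.2 h)).trans_lt ?_⟩
  simpa using hc.lt_top

lemma InBall.isLinfL2 {u : Period T → Ω → ℝ} (hu : InBall P ℱ u) : IsLinfL2 P ℱ u := by
  refine ⟨isStronglyProgressive_iff.2 hu.adapted, lt_of_le_of_lt (essSup_le_of_ae_le 1 ?_)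
    ENNReal.one_lt_top⟩
  refine ae_iff_of_countable.2 fun ω hω => ?_
  have := hu.le_one ω hω
  rw [pathNormSq, ← eLpNorm_two_sq] at this
  by_contra hlt
  exact (one_lt_pow₀ (not_le.1 hlt) two_ne_zero).not_ge this

end FixedPoint

/-! ### Adjointness of the Volterra operators and the role of the signal. -/

section Duality

variable {Ω : Type*} [MeasurableSpace Ω] {T : ℝ}

/-- Square integrable measurable processes, not necessarily adapted. -/
structure IsSqInt (P : Measure Ω) (u : Period T → Ω → ℝ) : Prop where
  path : ∀ ω, Measurable fun t => u t ω
  finite : normSq P u ≠ ∞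

/-- The pathwise inner product `∫₀ᵀ u_t(ω) v_t(ω) dt`. -/
def pathInner (u v : Period T → Ω → ℝ) (ω : Ω) : ℝ := ∫ t, u t ω * v t ω ∂(leb T)

variable {P : Measure Ω} [IsProbabilityMeasure P] {ℱ : Filtration (Period T) ‹MeasurableSpace Ω›}
  [Countable Ω] [DiscreteMeasurableSpace Ω]

lemma IsL2.isSqInt {u : Period T → Ω → ℝ} (hu : IsL2 P ℱ u) : IsSqInt P u :=
  ⟨hu.isAdapted.path, hu.2.ne⟩

lemma IsSqInt.memLp_path {u : Period T → Ω → ℝ} (hu : IsSqInt P u) {ω : Ω} (hω : P {ω} ≠ 0) :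
    MemLp (fun t => u t ω) 2 (leb T) :=
  memLp_two_of_lintegral (hu.path ω) (pathNormSq_ne_top hu.finite hω)

lemma IsSqInt.measurable_uncurry {u : Period T → Ω → ℝ} (hu : IsSqInt P u) :
    Measurable fun p : Period T × Ω => u p.1 p.2 := measurable_from_prod_countable_left hu.path

lemma IsSqInt.memLp {u : Period T → Ω → ℝ} (hu : IsSqInt P u) :
    MemLp (fun p : Period T × Ω => u p.1 p.2) 2 ((leb T).prod P) := by
  refine memLp_two_of_lintegral hu.measurable_uncurry ?_
  rw [lintegral_prod_symm _ (hu.measurable_uncurry.enorm.pow_const 2).aemeasurable]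
  exact hu.finite

lemma IsSqInt.sub {u v : Period T → Ω → ℝ} (hu : IsSqInt P u) (hv : IsSqInt P v) :
    IsSqInt P fun t ω => u t ω - v t ω := by
  refine ⟨fun ω => (hu.path ω).sub (hv.path ω), ne_top_of_le_ne_top ?_
    (lintegral_mono fun ω => pathNormSq_sub_le (hu.path ω))⟩
  rw [lintegral_const_mul' _ _ (by simp), lintegral_add_left Measurable.of_discrete]
  exact ENNReal.mul_ne_top (by simp) (ENNReal.add_ne_top.2 ⟨hu.finite, hv.finite⟩)

lemma isSqInt_of_memLp {X : Ω → ℝ} (hX : MemLp X 2 P) :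
    IsSqInt P fun (_ : Period T) ω => X ω := by
  refine ⟨fun ω => measurable_const, ?_⟩
  simp only [normSq, pathNormSq, lintegral_const]
  rw [lintegral_mul_const _ Measurable.of_discrete, ← eLpNorm_two_sq]
  exact ENNReal.mul_ne_top (ENNReal.pow_ne_top hX.2.ne) (measure_ne_top _ _)

lemma IsSqInt.integrable_mul {u v : Period T → Ω → ℝ} (hu : IsSqInt P u) (hv : IsSqInt P v) :
    Integrable (fun p : Period T × Ω => u p.1 p.2 * v p.1 p.2) ((leb T).prod P) :=
  MemLp.integrable_mul hu.memLp hv.memLp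

lemma IsSqInt.integrable_pathInner {u v : Period T → Ω → ℝ} (hu : IsSqInt P u)
    (hv : IsSqInt P v) : Integrable (pathInner u v) P := (hu.integrable_mul hv).integral_prod_right

lemma IsSqInt.inner2_eq {u v : Period T → Ω → ℝ} (hu : IsSqInt P u) (hv : IsSqInt P v) :
    inner2 P u v = ∫ t, ∫ ω, u t ω * v t ω ∂P ∂(leb T) :=
  (integral_prod_symm _ (hu.integrable_mul hv)).symm.trans
    (integral_prod _ (hu.integrable_mul hv))

/-- Pull the `ℱ t`-measurable factor into the conditional expectation, then take expectations. -/
lemma integral_condExp_mul {f w : Ω → ℝ} (hf : MemLp f 2 P) (hw : MemLp w 2 P) {t : Period T}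
    (hwm : StronglyMeasurable[ℱ t] w) :
    ∫ ω, (P[f | ℱ t]) ω * w ω ∂P = ∫ ω, f ω * w ω ∂P := by
  have h1 := condExp_mul_of_stronglyMeasurable_left hwm (hw.integrable_mul hf)
    (hf.integrable (by norm_num))
  rw [← integral_condExp (ℱ.le t) (f := fun ω => f ω * w ω)]
  refine integral_congr_ae ?_
  have h2 : (fun ω => f ω * w ω) = w * f := by
    funext ω
    exact mul_comm _ _
  rw [h2]
  filter_upwards [h1] with ω hω
  rw [hω, Pi.mul_apply, mul_comm]

lemma IsAdapted.stronglyMeasurable {u : Period T → Ω → ℝ} (hu : IsAdapted ℱ u) (t : Period T) :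
    StronglyMeasurable[ℱ t] (u t) :=
  (measurable_of_const_on_atoms (hu.const t)).stronglyMeasurable

/-- Test functions see `α` as `S_T - S`. -/
lemma inner2_alpha {hT : 0 < T} {S α w : Period T → Ω → ℝ} (hS : IsL2 P ℱ S)
    (hST : MemLp (S (finalTime hT)) 2 P) (hα : IsAlphaSignal P ℱ hT S α) (hα2 : IsL2 P ℱ α)
    (hw : IsL2 P ℱ w) :
    inner2 P α w = inner2 P (fun t ω => S (finalTime hT) ω - S t ω) w := by
  rw [hα2.isSqInt.inner2_eq hw.isSqInt,
    ((isSqInt_of_memLp hST).sub hS.isSqInt).inner2_eq hw.isSqInt]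
  refine integral_congr_ae ?_
  filter_upwards [hα.2, ae_memLp_slice hS, ae_memLp_slice hw] with t h1 h2 h3
  refine Eq.trans ?_ (integral_condExp_mul (hST.sub h2) h3 (hw.isAdapted.stronglyMeasurable t))
  refine integral_congr_ae ?_
  filter_upwards [h1] with ω hω
  rw [hω]
  rfl

lemma enorm_mul_le_add_sq (a b : ℝ) : ‖a * b‖ₑ ≤ ‖a‖ₑ ^ 2 + ‖b‖ₑ ^ 2 := by
  rw [Real.enorm_eq_ofReal_abs, enorm_sq_eq, enorm_sq_eq,
    ← ENNReal.ofReal_add (sq_nonneg _) (sq_nonneg _)]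
  apply ENNReal.ofReal_le_ofReal
  rw [abs_mul]
  nlinarith [sq_abs a, sq_abs b, sq_nonneg (|a| - |b|), sq_nonneg (|a| + |b|)]

/-- Bound the product by the sum of squares of `K(t,s) w_s` and `A`; integrating the first over `t ≥
s` costs the adjoint kernel constant. This licenses Fubini in the duality argument. -/
lemma integrable_kernel_mul {K : Period T → Period T → ℝ} (hK : IsGoodKernel K)
    {w : Period T → Ω → ℝ} (hw : IsSqInt P w) {A : Period T → Period T → Ω → ℝ}
    (hA : Measurable fun p : (Period T × Period T) × Ω => A p.1.1 p.1.2 p.2)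
    (hA2 : ∫⁻ ω, ∫⁻ s, ∫⁻ t, ‖A s t ω‖ₑ ^ 2 ∂(leb T) ∂(leb T) ∂P ≠ ∞) :
    Integrable (fun p : (Period T × Period T) × Ω =>
      ((Ici p.1.1).indicator (fun t => K t p.1.1) p.1.2 * w p.1.1 p.2) * A p.1.1 p.1.2 p.2)
      (((leb T).prod (leb T)).prod P) := by
  have hKm : Measurable fun q : Period T × Period T =>
      (Ici q.1).indicator (fun t => K t q.1) q.2 :=
    Measurable.indicator (f := fun q : Period T × Period T => K q.2 q.1)
      (hK.meas.comp measurable_swap) (measurableSet_le measurable_fst measurable_snd)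
  have hwm : Measurable fun p : (Period T × Period T) × Ω => w p.1.1 p.2 :=
    measurable_from_prod_countable_left fun ω => (hw.path ω).comp measurable_fst
  have hm1 : Measurable fun p : (Period T × Period T) × Ω =>
      (Ici p.1.1).indicator (fun t => K t p.1.1) p.1.2 * w p.1.1 p.2 :=
    (hKm.comp (measurable_fst (β := Ω))).mul hwm
  have hm := hm1.mul hA
  refine ⟨hm.aestronglyMeasurable, ?_⟩
  rw [hasFiniteIntegral_iff_enorm]
  refine (lintegral_mono fun p => enorm_mul_le_add_sq _ _).trans_lt ?_
  rw [lintegral_add_right _ (hA.enorm.pow_const 2),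
    lintegral_prod_symm _ ((hA.enorm.pow_const 2).aemeasurable)]
  refine ENNReal.add_lt_top.2 ⟨?_, ?_⟩
  · rw [lintegral_prod_symm _ ((hm1.enorm.pow_const 2).aemeasurable)]
    refine lt_of_le_of_lt (b := ∫⁻ ω, adjKernelConst K * pathNormSq w ω ∂P) ?_ ?_
    · refine lintegral_mono fun ω => ?_
      have hm2 : Measurable fun q : Period T × Period T =>
          (Ici q.1).indicator (fun t => K t q.1) q.2 * w q.1 ω := hm1.comp measurable_prodMk_right
      rw [lintegral_prod _ ((hm2.enorm.pow_const 2).aemeasurable), pathNormSq, ← lintegral_const_mul' _ _ hK.adjConst]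
      refine lintegral_mono fun s => ?_
      simp only [enorm_mul, mul_pow]
      rw [lintegral_mul_const' _ _ (by simp)]
      gcongr
      refine le_trans (le_of_eq ?_)
        (le_iSup (fun t => ∫⁻ s in Ici t, ‖K s t‖ₑ ^ 2 ∂(leb T)) s)
      rw [← lintegral_indicator measurableSet_Ici]
      refine lintegral_congr fun t => ?_
      by_cases ht : t ∈ Ici s
      · rw [indicator_of_mem ht, indicator_of_mem ht]
      · rw [indicator_of_notMem ht, indicator_of_notMem ht]
        simp
    · rw [lintegral_const_mul' _ _ hK.adjConst]
      exact ENNReal.mul_lt_top hK.adjConst.lt_top hw.finite.lt_top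
  · refine lt_of_eq_of_lt (lintegral_congr fun ω => ?_) hA2.lt_top
    exact lintegral_prod _ (((hA.comp measurable_prodMk_right).enorm.pow_const 2).aemeasurable)

lemma integral_triple_comm {F : (Period T × Period T) × Ω → ℝ}
    (hF : Integrable F (((leb T).prod (leb T)).prod P)) :
    (∫ ω, ∫ s, ∫ t, F ((s, t), ω) ∂(leb T) ∂(leb T) ∂P =
      ∫ p, ∫ ω, F (p, ω) ∂P ∂((leb T).prod (leb T))) ∧
    ∫ ω, ∫ t, ∫ s, F ((s, t), ω) ∂(leb T) ∂(leb T) ∂P =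
      ∫ p, ∫ ω, F (p, ω) ∂P ∂((leb T).prod (leb T)) := by
  have h1 := (integral_prod _ hF).symm.trans (integral_prod_symm _ hF)
  rw [h1]
  have h2 := hF.prod_left_ae
  constructor <;> refine integral_congr_ae ?_ <;> filter_upwards [h2] with ω hω
  · exact (integral_prod _ hω).symm
  · exact (integral_prod_symm _ hω).symm

/-- `adjOp` is the adjoint of the Volterra operator. -/
lemma inner2_volterra {K : Period T → Period T → ℝ} (hK : IsGoodKernel K)
    {q w : Period T → Ω → ℝ} (hq : IsL2 P ℱ q) (hw : IsL2 P ℱ w) :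
    inner2 P q (volterra K w) = inner2 P (adjOp P ℱ K q) w := by
  have hqm : Measurable fun p : (Period T × Period T) × Ω => q p.1.2 p.2 :=
    measurable_from_prod_countable_left fun ω => (hq.isAdapted.path ω).comp measurable_snd
  have hcm : Measurable fun p : (Period T × Period T) × Ω => condProc P ℱ q p.1.2 p.1.1 p.2 :=
    (measurable_condProc hq.isAdapted.path).comp
      (g := fun p : (Period T × Period T) × Ω => condProc P ℱ q p.1.1 p.1.2 p.2)
      (f := fun p : (Period T × Period T) × Ω => ((p.1.2, p.1.1), p.2)) (by fun_prop)
  have i1 := integrable_kernel_mul (P := P) hK hw.isSqInt (A := fun _ t ω => q t ω) hqm (by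
    simp only [lintegral_const]
    rw [lintegral_mul_const _ Measurable.of_discrete]
    exact ENNReal.mul_ne_top hq.2.ne (measure_ne_top _ _))
  have i2 := integrable_kernel_mul (P := P) hK hw.isSqInt
    (A := fun s t ω => condProc P ℱ q t s ω) hcm (by
    refine ne_top_of_le_ne_top ?_ (lintegral_mono fun ω => lintegral_mono fun s =>
      lintegral_condProc_sq_le hq.isAdapted.path s ω)
    rw [← lintegral_lintegral_swap (f := fun t ω => condNormSq P ℱ q t ω)
      (measurable_condNormSq q).aemeasurable]
    simp only [condNormSq, lintegral_lintegral_condMeas, lintegral_const]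
    exact ENNReal.mul_ne_top hq.2.ne (measure_ne_top _ _))
  have e1 : inner2 P q (volterra K w) = ∫ ω, ∫ t, ∫ s,
      ((Ici s).indicator (fun t => K t s) t * w s ω) * q t ω ∂(leb T) ∂(leb T) ∂P := by
    refine integral_congr_ae (Filter.Eventually.of_forall fun ω =>
      integral_congr_ae (Filter.Eventually.of_forall fun t => ?_))
    simp only [volterra]
    rw [← integral_indicator measurableSet_Iic, mul_comm, ← integral_mul_const]
    refine integral_congr_ae (Filter.Eventually.of_forall fun s => ?_)
    by_cases hst : s ≤ t
    · simp only [indicator_of_mem (mem_Iic.2 hst), indicator_of_mem (mem_Ici.2 hst)]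
    · simp only [indicator_of_notMem (fun h => hst (mem_Iic.1 h)),
        indicator_of_notMem (fun h => hst (mem_Ici.1 h)), zero_mul]
  have e2 : inner2 P (adjOp P ℱ K q) w = ∫ ω, ∫ s, ∫ t,
      ((Ici s).indicator (fun t => K t s) t * w s ω) * condProc P ℱ q t s ω
        ∂(leb T) ∂(leb T) ∂P := by
    refine integral_congr_ae (Filter.Eventually.of_forall fun ω =>
      integral_congr_ae (Filter.Eventually.of_forall fun s => ?_))
    simp only [adjOp]
    rw [← integral_indicator measurableSet_Ici, ← integral_mul_const]
    refine integral_congr_ae (Filter.Eventually.of_forall fun t => ?_)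
    by_cases hst : s ≤ t
    · simp only [indicator_of_mem (mem_Ici.2 hst)]
      ring
    · simp only [indicator_of_notMem (fun h => hst (mem_Ici.1 h)), zero_mul]
  -- With the expectation innermost, the claim at fixed `(s, t)` is `𝔼[q_t w_s] = 𝔼[𝔼_s[q_t] w_s]`,
  -- valid because `w_s` is `ℱ s`-measurable.
  rw [e1, e2, (integral_triple_comm i1).2, (integral_triple_comm i2).1]
  refine integral_congr_ae ?_
  filter_upwards [Measure.quasiMeasurePreserving_fst.ae (ae_memLp_slice hw),
    Measure.quasiMeasurePreserving_snd.ae (ae_memLp_slice hq)] with p h1 h2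
  have h3 := integral_condExp_mul h2 h1 (hw.isAdapted.stronglyMeasurable p.1)
  simp only [mul_assoc, integral_const_mul]
  congr 1
  simp only [mul_comm (w p.1 _)]
  rw [← h3]
  refine integral_congr_ae (ae_iff_of_countable.2 fun ω hω => ?_)
  simp only
  rw [condExp_eq_integral_condMeas (h2.integrable (by norm_num)) p.1 hω]
  rfl

end Duality

/-! ### Inventory penalties as Volterra operators with the kernel `kernelH`. -/

section Inventory

variable {T : ℝ}

lemma leb_real_Ici (t : Period T) : (leb T).real (Ici t) = T - t := by
  rw [measureReal_def, leb_Ici, ENNReal.toReal_ofReal (by linarith [t.2.2])]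

lemma ae_ne_prod : ∀ᵐ p ∂((leb T).prod (leb T)), p.1 ≠ p.2 := by
  rw [ae_iff]
  have : {p : Period T × Period T | ¬ p.1 ≠ p.2} = {p | p.1 = p.2} := by
    ext p
    simp
  rw [this, Measure.measure_prod_null (measurableSet_eq_fun measurable_fst measurable_snd)]
  refine Filter.Eventually.of_forall fun s => ?_
  have : Prod.mk s ⁻¹' {p : Period T × Period T | p.1 = p.2} = {s} := by
    ext t
    simp [eq_comm]
  simp [this]

lemma integral_kernel_swap {k : Period T → Period T → ℝ} (hk : Measurable (Function.uncurry k))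
    {c : ℝ} (hc : ∀ s t, ‖k s t‖ ≤ c) {a b : Period T → ℝ} (ha : Integrable a (leb T))
    (hb : Integrable b (leb T)) :
    (∫ t, (∫ s, k s t * a s ∂(leb T)) * b t ∂(leb T) =
      ∫ p, k p.1 p.2 * (a p.1 * b p.2) ∂((leb T).prod (leb T))) ∧
    ∫ s, a s * (∫ t, k s t * b t ∂(leb T)) ∂(leb T) =
      ∫ p, k p.1 p.2 * (a p.1 * b p.2) ∂((leb T).prod (leb T)) := by
  have hi : Integrable (fun p : Period T × Period T => k p.1 p.2 * (a p.1 * b p.2))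
      ((leb T).prod (leb T)) :=
    (ha.mul_prod hb).bdd_mul hk.aestronglyMeasurable
      (Filter.Eventually.of_forall fun p => hc p.1 p.2)
  constructor
  · rw [integral_prod_symm _ hi]
    refine integral_congr_ae (Filter.Eventually.of_forall fun t => ?_)
    simp only [← integral_mul_const, mul_assoc]
  · rw [integral_prod _ hi]
    refine integral_congr_ae (Filter.Eventually.of_forall fun s => ?_)
    simp only [← integral_const_mul]
    refine integral_congr_ae (Filter.Eventually.of_forall fun t => ?_)
    ring

/-- Fubini with the kernel `1_{s ≤ t}`: the time `s` is counted for a duration `T - s`. -/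
lemma integral_primitive {b : Period T → ℝ} (hb : Integrable b (leb T)) :
    ∫ t, (∫ s in Iic t, b s ∂(leb T)) ∂(leb T) = ∫ s, (T - s) * b s ∂(leb T) := by
  have hm : Measurable (Function.uncurry fun s t : Period T => if s ≤ t then (1 : ℝ) else 0) :=
    Measurable.ite (measurableSet_le measurable_fst measurable_snd) measurable_const
      measurable_const
  have h := integral_kernel_swap hm (c := 1) (fun s t => by split_ifs <;> simp) hb
    (integrable_const (1 : ℝ))
  have h2 := h.1.trans h.2.symm
  refine Eq.trans ?_ (h2.trans ?_)
  · refine integral_congr_ae (Filter.Eventually.of_forall fun t => ?_)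
    simp only [← integral_indicator measurableSet_Iic, mul_one]
    refine integral_congr_ae (Filter.Eventually.of_forall fun s => ?_)
    by_cases hst : s ≤ t <;> simp [hst]
  · refine integral_congr_ae (Filter.Eventually.of_forall fun s => ?_)
    simp only [mul_one]
    rw [mul_comm, ← leb_real_Ici s]
    congr 1
    rw [← integral_indicator_one measurableSet_Ici]
    refine integral_congr_ae (Filter.Eventually.of_forall fun t => ?_)
    by_cases hst : s ≤ t <;> simp [hst]

/-- For a pair of times, both primitives have picked up their contribution exactly when `r` is past
the later one. -/
lemma integral_primitive_mul_primitive {a b : Period T → ℝ} (ha : Integrable a (leb T))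
    (hb : Integrable b (leb T)) :
    ∫ r, (∫ s in Iic r, a s ∂(leb T)) * (∫ s in Iic r, b s ∂(leb T)) ∂(leb T) =
      ∫ p, (T - (max p.1 p.2 : Period T)) * (a p.1 * b p.2) ∂((leb T).prod (leb T)) := by
  set k : Period T → Period T × Period T → ℝ := fun r p => if p.1 ≤ r ∧ p.2 ≤ r then 1 else 0
  have hk : Measurable (Function.uncurry k) := by
    refine Measurable.ite ?_ measurable_const measurable_const
    have h1 : Measurable fun q : Period T × (Period T × Period T) => q.2.1 := by fun_prop
    have h2 : Measurable fun q : Period T × (Period T × Period T) => q.2.2 := by fun_prop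
    have h3 := measurableSet_le h1 measurable_fst
    have h4 := measurableSet_le h2 measurable_fst
    exact h3.inter h4
  have hab := ha.mul_prod hb
  have hi : Integrable (fun q : Period T × (Period T × Period T) =>
      k q.1 q.2 * (a q.2.1 * b q.2.2)) ((leb T).prod ((leb T).prod (leb T))) := by
    have := ((integrable_const (μ := leb T) (1 : ℝ)).mul_prod hab).bdd_mul
      (c := 1) hk.aestronglyMeasurable (Filter.Eventually.of_forall fun q => by
        simp only [Function.uncurry, k]
        split_ifs <;> simp)
    simpa only [one_mul, Function.uncurry] using this
  have e1 : ∀ r, (∫ s in Iic r, a s ∂(leb T)) * (∫ s in Iic r, b s ∂(leb T)) =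
      ∫ p, k r p * (a p.1 * b p.2) ∂((leb T).prod (leb T)) := fun r => by
    rw [← integral_indicator measurableSet_Iic, ← integral_indicator measurableSet_Iic,
      ← integral_prod_mul]
    refine integral_congr_ae (Filter.Eventually.of_forall fun p => ?_)
    by_cases h1 : p.1 ≤ r <;> by_cases h2 : p.2 ≤ r <;> simp [k, h1, h2]
  simp_rw [e1]
  rw [integral_integral_swap hi]
  refine integral_congr_ae (Filter.Eventually.of_forall fun p => ?_)
  simp only [integral_mul_const]
  congr 1
  have h3 : ∀ r, k r p = (Ici (max p.1 p.2)).indicator 1 r := fun r => by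
    by_cases h1 : p.1 ≤ r <;> by_cases h2 : p.2 ≤ r <;> simp [k, h1, h2]
  simp_rw [h3]
  rw [integral_indicator_one measurableSet_Ici, leb_real_Ici]

lemma norm_kernelH_le (φ ϱ : ℝ) (t s : Period T) : ‖kernelH φ ϱ t s‖ ≤ |φ| * |T| + |ϱ| := by
  rw [kernelH]
  split_ifs
  · refine (norm_add_le _ _).trans ?_
    have h : |T - t| ≤ |T| :=
      abs_le_abs_of_nonneg (by linarith [t.2.2]) (by linarith [t.2.1])
    rw [norm_mul]
    simp only [Real.norm_eq_abs]
    gcongr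
  · simp only [norm_zero]
    positivity

lemma setIntegral_kernelH (φ ϱ : ℝ) (a : Period T → ℝ) (t : Period T) :
    ∫ s in Iic t, kernelH φ ϱ t s * a s ∂(leb T) = ∫ s, kernelH φ ϱ t s * a s ∂(leb T) := by
  refine setIntegral_eq_integral_of_forall_compl_eq_zero fun s hs => ?_
  rw [kernelH, if_neg fun h => hs (mem_Iic.2 h.le), zero_mul]

lemma setIntegral_Iic_finalTime (hT : 0 < T) (a : Period T → ℝ) :
    ∫ s in Iic (finalTime hT), a s ∂(leb T) = ∫ s, a s ∂(leb T) := by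
  have : Iic (finalTime hT) = univ := eq_univ_of_forall fun t => t.2.2
  rw [this, setIntegral_univ]

lemma integral_weight_mul (hT : 0 < T) (φ ϱ : ℝ) {b : Period T → ℝ} (hb : Integrable b (leb T)) :
    φ * ∫ t, (∫ s in Iic t, b s ∂(leb T)) ∂(leb T)
      + ϱ * ∫ s in Iic (finalTime hT), b s ∂(leb T) =
    ∫ t, (φ * (T - t) + ϱ) * b t ∂(leb T) := by
  have hi : Integrable (fun t : Period T => (T - t) * b t) (leb T) := by
    refine hb.bdd_mul (c := |T|) ?_ (Filter.Eventually.of_forall fun t => ?_)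
    · exact (measurable_const.sub measurable_subtype_coe).aestronglyMeasurable
    · exact abs_le_abs_of_nonneg (by linarith [t.2.2]) (by linarith [t.2.1])
  rw [integral_primitive hb, setIntegral_Iic_finalTime, ← integral_const_mul,
    ← integral_const_mul, ← integral_add (hi.const_mul _) (hb.const_mul _)]
  refine integral_congr_ae (Filter.Eventually.of_forall fun t => ?_)
  ring

/-- Integration by parts for the inventory penalties. -/
lemma inventory_identity (hT : 0 < T) (φ ϱ : ℝ) {a b : Period T → ℝ}
    (ha : Integrable a (leb T)) (hb : Integrable b (leb T)) :
    φ * ∫ t, (∫ s in Iic t, a s ∂(leb T)) * (∫ s in Iic t, b s ∂(leb T)) ∂(leb T)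
      + ϱ * ((∫ s in Iic (finalTime hT), a s ∂(leb T))
        * ∫ s in Iic (finalTime hT), b s ∂(leb T)) =
    ∫ t, (∫ s in Iic t, kernelH φ ϱ t s * a s ∂(leb T)) * b t ∂(leb T)
      + ∫ t, a t * (∫ s in Iic t, kernelH φ ϱ t s * b s ∂(leb T)) ∂(leb T) := by
  have hab := ha.mul_prod hb
  have hHm : Measurable fun p : Period T × Period T => kernelH φ ϱ p.1 p.2 :=
    (isGoodKernel_kernelH (T := T) φ ϱ).meas
  have hHs : Measurable fun p : Period T × Period T => kernelH φ ϱ p.2 p.1 :=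
    hHm.comp measurable_swap
  have h1 := (integral_kernel_swap (k := fun s t => kernelH φ ϱ t s) hHs
    (fun s t => norm_kernelH_le φ ϱ t s) ha hb).1
  have h2 := (integral_kernel_swap (k := kernelH φ ϱ) hHm (norm_kernelH_le φ ϱ) ha hb).2
  have hmax : Integrable (fun p : Period T × Period T => (T - (max p.1 p.2 : Period T)) *
      (a p.1 * b p.2)) ((leb T).prod (leb T)) := by
    refine hab.bdd_mul (c := |T|) ?_ (Filter.Eventually.of_forall fun p => ?_)
    · exact (measurable_const.sub (measurable_subtype_coe.comp
        (measurable_fst.max measurable_snd))).aestronglyMeasurable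
    · exact abs_le_abs_of_nonneg (by linarith [(max p.1 p.2).2.2])
        (by linarith [(max p.1 p.2).2.1])
  simp only [setIntegral_kernelH]
  rw [h1, h2, integral_primitive_mul_primitive ha hb, setIntegral_Iic_finalTime,
    setIntegral_Iic_finalTime, ← integral_prod_mul, ← integral_const_mul, ← integral_const_mul,
    ← integral_add
      (hab.bdd_mul hHs.aestronglyMeasurable
        (Filter.Eventually.of_forall fun p => norm_kernelH_le φ ϱ p.2 p.1))
      (hab.bdd_mul hHm.aestronglyMeasurable
        (Filter.Eventually.of_forall fun p => norm_kernelH_le φ ϱ p.1 p.2)),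
    ← integral_add (hmax.const_mul φ) (hab.const_mul ϱ)]
  refine integral_congr_ae ?_
  -- Off the null diagonal exactly one of the indicators in `H(s,t)` and `H(t,s)` is one, and there
  -- the weight is `φ (T - max s t) + ϱ`. On the diagonal both kernels vanish.
  filter_upwards [ae_ne_prod] with p hp
  rcases lt_or_gt_of_ne hp with h | h
  · simp only [kernelH, if_pos h, if_neg h.not_gt, max_eq_right h.le]
    ring
  · simp only [kernelH, if_pos h, if_neg h.not_gt, max_eq_left h.le]
    ring

end Inventory

/-! ### Second-order estimate of the trading cost. -/

section Calculus

/-- Mean value inequality for `x ↦ h x - h'(z) x` on the ball of radius `|d|` around `z`, where its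
derivative is at most `L |d|`. -/
lemma abs_taylor_le {h : ℝ → ℝ} {L : ℝ≥0} (hd : Differentiable ℝ h)
    (hL : LipschitzWith L (deriv h)) (z d : ℝ) :
    |h (z + d) - h z - deriv h z * d| ≤ L * d ^ 2 := by
  have h1 := (convex_closedBall z |d|).norm_image_sub_le_of_norm_hasDerivWithin_le
    (f := fun x => h x - deriv h z * x) (f' := fun x => deriv h x - deriv h z) (C := L * |d|)
    (x := z) (y := z + d)
    (fun x _ => ((hd x).hasDerivAt.sub ((hasDerivAt_id x).const_mul _ |>.congr_deriv
      (mul_one _))).hasDerivWithinAt)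
    (fun x hx => by
      refine (hL.dist_le_mul x z).trans ?_
      gcongr
      exact hx)
    (Metric.mem_closedBall_self (abs_nonneg d))
    (by simp)
  have e : h (z + d) - deriv h z * (z + d) - (h z - deriv h z * z) =
    h (z + d) - h z - deriv h z * d := by ring
  rw [e, add_sub_cancel_left, Real.norm_eq_abs, Real.norm_eq_abs, mul_assoc, ← pow_two,
    sq_abs] at h1
  exact h1

variable {X : Type*} [MeasurableSpace X] {ν : Measure X}

/-- The pattern is that of the first variation; it is integrated in time along a path and also in
expectation. -/
lemma integral_comb_seven {f₁ f₂ f₃ f₄ f₅ f₆ f₇ : X → ℝ} (c d : ℝ) (h₁ : Integrable f₁ ν)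
    (h₂ : Integrable f₂ ν) (h₃ : Integrable f₃ ν) (h₄ : Integrable f₄ ν) (h₅ : Integrable f₅ ν)
    (h₆ : Integrable f₆ ν) (h₇ : Integrable f₇ ν) :
    Integrable (fun x => f₁ x - c * f₂ x - f₃ x - f₄ x - f₅ x - f₆ x - d * f₇ x) ν ∧
    ∫ x, (f₁ x - c * f₂ x - f₃ x - f₄ x - f₅ x - f₆ x - d * f₇ x) ∂ν =
      ∫ x, f₁ x ∂ν - c * ∫ x, f₂ x ∂ν - ∫ x, f₃ x ∂ν - ∫ x, f₄ x ∂ν - ∫ x, f₅ x ∂ν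
        - ∫ x, f₆ x ∂ν - d * ∫ x, f₇ x ∂ν := by
  have i2 : Integrable (fun x => f₁ x - c * f₂ x) ν := h₁.sub (h₂.const_mul c)
  have i3 : Integrable (fun x => f₁ x - c * f₂ x - f₃ x) ν := i2.sub h₃
  have i4 : Integrable (fun x => f₁ x - c * f₂ x - f₃ x - f₄ x) ν := i3.sub h₄
  have i5 : Integrable (fun x => f₁ x - c * f₂ x - f₃ x - f₄ x - f₅ x) ν := i4.sub h₅
  have i6 : Integrable (fun x => f₁ x - c * f₂ x - f₃ x - f₄ x - f₅ x - f₆ x) ν := i5.sub h₆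
  refine ⟨i6.sub (h₇.const_mul d), ?_⟩
  rw [← integral_const_mul, ← integral_const_mul, ← integral_sub h₁ (h₂.const_mul c),
    ← integral_sub i2 h₃, ← integral_sub i3 h₄, ← integral_sub i4 h₅, ← integral_sub i5 h₆,
    ← integral_sub i6 (h₇.const_mul d)]

/-- The loss in the quadratic estimate of the performance functional. -/
def lossConst (M L c m : ℝ) : ℝ := M / 2 * (c * m + 1) + L * c / 2 * (m + 1)

/-- Besides the first-order terms, `h(z + d)(a + b)` leaves `(h(z + d) - h(z))b`, handled by the
Lipschitz bound and Young's inequality, and the Taylor remainder times `a`, handled by `2|a| ≤ 1 +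
a²`. -/
lemma impact_cost_le {h : ℝ → ℝ} {M L : ℝ} (hM : ∀ x y, |h x - h y| ≤ M * |x - y|)
    (hL : ∀ z d, |h (z + d) - h z - deriv h z * d| ≤ L * d ^ 2) (S a b z d γ : ℝ) :
    -((S + γ / 2 * (a + b) + h (z + d)) * (a + b)) ≤
      -((S + γ / 2 * a + h z) * a) - S * b - γ * (a * b) - h z * b - deriv h z * a * d
        - γ / 2 * (b * b) + (M / 2 * (d ^ 2 + b * b) + L / 2 * (d ^ 2 * (1 + a * a))) := by
  have h1 : |(h (z + d) - h z) * b| ≤ M / 2 * (d ^ 2 + b * b) := by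
    have hM0 : 0 ≤ M := by simpa using (abs_nonneg _).trans (hM 1 0)
    have h2 := hM (z + d) z
    rw [add_sub_cancel_left] at h2
    rw [abs_mul]
    calc _ ≤ M * |d| * |b| := by gcongr
      _ = M * (|d| * |b|) := mul_assoc _ _ _
      _ ≤ M * ((d ^ 2 + b * b) / 2) := by
          gcongr
          nlinarith [sq_nonneg (|d| - |b|), sq_abs d, sq_abs b]
      _ = _ := by ring
  have h2 : |(h (z + d) - h z - deriv h z * d) * a| ≤ L / 2 * (d ^ 2 * (1 + a * a)) := by
    have hL0 : 0 ≤ L := by simpa using (abs_nonneg _).trans (hL 0 1)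
    rw [abs_mul]
    calc _ ≤ L * d ^ 2 * |a| := by gcongr; exact hL z d
      _ ≤ L * d ^ 2 * ((1 + a * a) / 2) := by
          gcongr
          nlinarith [sq_nonneg (|a| - 1), sq_abs a]
      _ = _ := by ring
  have h3 := (abs_le.1 h1).1
  have h4 := (abs_le.1 h2).1
  nlinarith

/-- Since `d²` is bounded uniformly by `c ∫ b²` and `∫ a² ≤ 1`, even the error `d² a²` integrates to
a multiple of `∫ b²`, which `γ/2` can absorb. -/
lemma integral_impact_cost_le [IsFiniteMeasure ν] {h : ℝ → ℝ} {M L c γ : ℝ} (hc : 0 ≤ c)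
    (hM : ∀ x y, |h x - h y| ≤ M * |x - y|)
    (hL : ∀ z d, |h (z + d) - h z - deriv h z * d| ≤ L * d ^ 2) {S a b z d : X → ℝ}
    (iS : MemLp S 2 ν) (ia : MemLp a 2 ν) (ib : MemLp b 2 ν) (iz : MemLp (fun x => h (z x)) 2 ν)
    (izd : MemLp (fun x => h (z x + d x)) 2 ν) (iq : MemLp (fun x => deriv h (z x) * a x) 2 ν)
    (id : MemLp d 2 ν) (hd : ∀ x, d x ^ 2 ≤ c * ∫ x, b x * b x ∂ν)
    (ha1 : ∫ x, a x * a x ∂ν ≤ 1) :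
    -∫ x, (S x + γ / 2 * (a x + b x) + h (z x + d x)) * (a x + b x) ∂ν ≤
      -∫ x, (S x + γ / 2 * a x + h (z x)) * a x ∂ν +
      (-∫ x, S x * b x ∂ν - γ * ∫ x, a x * b x ∂ν - ∫ x, h (z x) * b x ∂ν
        - ∫ x, deriv h (z x) * a x * d x ∂ν)
      + (lossConst M L c (ν.real univ) - γ / 2) * ∫ x, b x * b x ∂ν := by
  have hM0 : 0 ≤ M := by simpa using (abs_nonneg _).trans (hM 1 0)
  have hL0 : 0 ≤ L := by simpa using (abs_nonneg _).trans (hL 0 1)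
  set n := ∫ x, b x * b x ∂ν
  have hn : 0 ≤ n := integral_nonneg fun x => mul_self_nonneg _
  have i0 : Integrable (fun x => (S x + γ / 2 * (a x + b x) + h (z x + d x)) * (a x + b x)) ν :=
    ((iS.add ((ia.add ib).const_mul (γ / 2))).add izd).integrable_mul (ia.add ib)
  have i1 : Integrable (fun x => (S x + γ / 2 * a x + h (z x)) * a x) ν :=
    ((iS.add (ia.const_mul (γ / 2))).add iz).integrable_mul ia
  have i2 : Integrable (fun x => S x * b x) ν := iS.integrable_mul ib
  have i3 : Integrable (fun x => a x * b x) ν := ia.integrable_mul ib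
  have i4 : Integrable (fun x => h (z x) * b x) ν := iz.integrable_mul ib
  have i5 : Integrable (fun x => deriv h (z x) * a x * d x) ν := iq.integrable_mul id
  have i6 : Integrable (fun x => b x * b x) ν := ib.integrable_mul ib
  have i7 : Integrable (fun x => a x * a x) ν := ia.integrable_mul ia
  have i8 : Integrable (fun x => L * (c * n) / 2 * (1 + a x * a x)) ν :=
    ((integrable_const 1).add i7).const_mul _
  have i9 : Integrable (fun x => M / 2 * (c * n + b x * b x)) ν :=
    ((integrable_const _).add i6).const_mul _
  have i10 : Integrable (fun x => -((S x + γ / 2 * a x + h (z x)) * a x)) ν := i1.neg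
  have i11 : Integrable (fun _ => (0 : ℝ)) ν := integrable_zero _ _ _
  -- Only six terms occur here; the zero function fills the sixth slot.
  obtain ⟨i12, e12⟩ := integral_comb_seven γ (γ / 2) i10 i3 i2 i4 i5 i11 i6
  have i13 : Integrable (fun x => -((S x + γ / 2 * a x + h (z x)) * a x) - γ * (a x * b x)
      - S x * b x - h (z x) * b x - deriv h (z x) * a x * d x - 0 - γ / 2 * (b x * b x)
      + M / 2 * (c * n + b x * b x)) ν := i12.add i9
  have key : ∫ x, -((S x + γ / 2 * (a x + b x) + h (z x + d x)) * (a x + b x)) ∂ν ≤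
      ∫ x, (-((S x + γ / 2 * a x + h (z x)) * a x) - γ * (a x * b x)
      - S x * b x - h (z x) * b x - deriv h (z x) * a x * d x - 0 - γ / 2 * (b x * b x)
      + M / 2 * (c * n + b x * b x) + L * (c * n) / 2 * (1 + a x * a x)) ∂ν :=
    integral_mono i0.neg (i13.add i8) (fun x => by
      refine (impact_cost_le hM hL (S x) (a x) (b x) (z x) (d x) γ).trans ?_
      have e1 : M / 2 * (d x ^ 2 + b x * b x) ≤ M / 2 * (c * n + b x * b x) := by
        gcongr
        exact hd x
      have e2 : L / 2 * (d x ^ 2 * (1 + a x * a x)) ≤ L * (c * n) / 2 * (1 + a x * a x) := by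
        have : L * (c * n) / 2 * (1 + a x * a x) = L / 2 * (c * n * (1 + a x * a x)) := by ring
        rw [this]
        gcongr
        · nlinarith [mul_self_nonneg (a x)]
        · exact hd x
      linarith)
  rw [integral_neg, integral_add i13 i8, integral_add i12 i9, e12, integral_neg,
    integral_const_mul (M / 2), integral_const_mul (L * (c * n) / 2),
    integral_add (integrable_const _) i6, integral_add (integrable_const _) i7,
    show ∫ x, b x * b x ∂ν = n from rfl] at key
  simp only [integral_const, smul_eq_mul, mul_one, mul_zero] at key
  have e4 : L * (c * n) / 2 * (ν.real univ + ∫ x, a x * a x ∂ν) ≤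
      L * (c * n) / 2 * (ν.real univ + 1) := by gcongr
  rw [lossConst]
  linarith

end Calculus

/-! ### First variation and optimality of the fixed point. -/

section Optimality

variable {Ω : Type*} [MeasurableSpace Ω] {T : ℝ}
  {P : Measure Ω} [IsProbabilityMeasure P] {ℱ : Filtration (Period T) ‹MeasurableSpace Ω›}
  [Countable Ω] [DiscreteMeasurableSpace Ω]
  {h : ℝ → ℝ} {G : Period T → Period T → ℝ} {g S α : Period T → Ω → ℝ} {M L : ℝ≥0}

lemma IsSqInt.pathNormSq_eq {u : Period T → Ω → ℝ} (hu : IsSqInt P u) {ω : Ω} (hω : P {ω} ≠ 0) :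
    pathNormSq u ω = ENNReal.ofReal (pathInner u u ω) := by
  have hi : Integrable (fun t => u t ω * u t ω) (leb T) :=
    (hu.memLp_path hω).integrable_mul (hu.memLp_path hω)
  rw [pathInner, ofReal_integral_eq_lintegral_ofReal hi
    (Filter.Eventually.of_forall fun t => mul_self_nonneg _), pathNormSq]
  refine lintegral_congr fun t => ?_
  rw [enorm_sq_eq, pow_two]

lemma isGoodKernel_one : IsGoodKernel (fun _ _ : Period T => (1 : ℝ)) :=
  isGoodKernel_of_bounded measurable_const (c := 1) (by simp)

lemma inventory_eq (X₀ : ℝ) (u : Period T → Ω → ℝ) (t : Period T) (ω : Ω) :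
    inventory X₀ u t ω = X₀ + volterra (fun _ _ => 1) u t ω := by
  simp [inventory, volterra]

lemma IsL2.det {a : Period T → ℝ} (ha : Measurable a) (ha2 : MemLp a 2 (leb T)) :
    IsL2 P ℱ fun t _ => a t := by
  rw [isL2_iff]
  refine ⟨.det ha, ?_⟩
  simp only [normSq, pathNormSq, ← eLpNorm_two_sq, lintegral_const, measure_univ, mul_one]
  exact ENNReal.pow_lt_top ha2.2

lemma IsL2.const (c : ℝ) : IsL2 P ℱ fun (_ : Period T) (_ : Ω) => c :=
  .det measurable_const (memLp_const c)

lemma IsL2.const_mul {u : Period T → Ω → ℝ} (hu : IsL2 P ℱ u) (c : ℝ) :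
    IsL2 P ℱ fun t ω => c * u t ω := by
  rw [isL2_iff] at *
  refine ⟨hu.1.comp (measurable_const_mul c), ?_⟩
  rw [normSq_const_mul]
  exact ENNReal.mul_lt_top (by simp) hu.2

lemma isL2_weight (φ ϱ : ℝ) :
    IsL2 P ℱ fun (t : Period T) (_ : Ω) => φ * (T - t) + ϱ := by
  refine .det (by fun_prop) ?_
  refine MemLp.of_bound (C := |φ| * |T| + |ϱ|) (by fun_prop)
    (Filter.Eventually.of_forall fun t => ?_)
  refine (norm_add_le _ _).trans ?_
  have h : |T - t| ≤ |T| :=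
    abs_le_abs_of_nonneg (by linarith [t.2.2]) (by linarith [t.2.1])
  rw [norm_mul]
  simp only [Real.norm_eq_abs]
  gcongr

lemma IsL2.inventory {u : Period T → Ω → ℝ} (hu : IsL2 P ℱ u) (X₀ : ℝ) :
    IsL2 P ℱ (inventory X₀ u) := by
  have := (IsL2.const (P := P) (ℱ := ℱ) X₀).add (hu.volterra isGoodKernel_one)
  simpa only [← inventory_eq] using this

lemma IsL2.memLp_volterra {K : Period T → Period T → ℝ} (hK : IsGoodKernel K)
    {u : Period T → Ω → ℝ} (hu : IsL2 P ℱ u) (t : Period T) : MemLp (OptimalTrading.volterra K u t) 2 P := by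
  refine memLp_two_of_lintegral Measurable.of_discrete (ne_top_of_le_ne_top ?_
    (lintegral_mono fun ω => enorm_volterra_sq_le hK.meas (hu.isAdapted.path ω) t))
  rw [lintegral_const_mul' _ _ hK.const]
  exact ENNReal.mul_ne_top hK.const hu.2.ne

lemma IsL2.memLp_inventory {u : Period T → Ω → ℝ} (hu : IsL2 P ℱ u) (X₀ : ℝ) (t : Period T) :
    MemLp (OptimalTrading.inventory X₀ u t) 2 P := by
  have := (memLp_const (μ := P) (p := 2) X₀).add (hu.memLp_volterra isGoodKernel_one t)
  refine this.congr_norm Measurable.of_discrete.aestronglyMeasurable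
    (Filter.Eventually.of_forall fun ω => ?_)
  rw [inventory_eq]
  rfl

/-- The random variable whose expectation is the performance functional. -/
def payoff (hT : 0 < T) (X₀ φ ϱ γ : ℝ) (h : ℝ → ℝ) (G : Period T → Period T → ℝ)
    (g S u : Period T → Ω → ℝ) (ω : Ω) : ℝ :=
  -(∫ t, execPrice γ h G g S u t ω * u t ω ∂(leb T))
    + inventory X₀ u (finalTime hT) ω * S (finalTime hT) ω
    - φ / 2 * ∫ t, inventory X₀ u t ω ^ 2 ∂(leb T)
    - ϱ / 2 * inventory X₀ u (finalTime hT) ω ^ 2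

lemma integrable_payoff (hd : RegularData P ℱ h G g M L) {hT : 0 < T} (X₀ φ ϱ γ : ℝ)
    (hS : IsL2 P ℱ S) (hST : MemLp (S (finalTime hT)) 2 P) {u : Period T → Ω → ℝ}
    (hu : IsL2 P ℱ u) : Integrable (payoff hT X₀ φ ϱ γ h G g S u) P := by
  have hX := hu.memLp_inventory X₀ (finalTime hT)
  have h1 : IsL2 P ℱ (execPrice γ h G g S u) :=
    (hS.add (hu.const_mul (γ / 2))).add ((hd.isL2_impactState hu).comp_lipschitz hd.lipschitz)
  have h2 := (hu.inventory X₀).isSqInt.integrable_pathInner (hu.inventory X₀).isSqInt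
  have h3 : pathInner (inventory X₀ u) (inventory X₀ u) =
      fun ω => ∫ t, inventory X₀ u t ω ^ 2 ∂(leb T) := by
    funext ω
    simp only [pathInner, pow_two]
  rw [h3] at h2
  exact (((h1.isSqInt.integrable_pathInner hu.isSqInt).neg.add (hX.integrable_mul hST)).sub
    (h2.const_mul _)).sub (hX.integrable_sq.const_mul _)

/-- The first variation of the payoff at `a` in the direction `b`. -/
def variation (hT : 0 < T) (X₀ φ ϱ γ : ℝ) (h : ℝ → ℝ) (G : Period T → Period T → ℝ)
    (g S a b : Period T → Ω → ℝ) (ω : Ω) : ℝ :=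
  pathInner (fun t ω => S (finalTime hT) ω - S t ω) b ω - γ * pathInner a b ω
    - pathInner (fun t ω => h (impactState G g a t ω)) b ω
    - pathInner (weightedProc h G g a) (volterra G b) ω
    - pathInner (volterra (kernelH φ ϱ) a) b ω
    - pathInner a (volterra (kernelH φ ϱ) b) ω
    - X₀ * pathInner (fun t _ => φ * (T - t) + ϱ) b ω

lemma impactState_add (hG : IsGoodKernel G) {a b : Period T → Ω → ℝ} (ha : IsL2 P ℱ a)
    (hb : IsL2 P ℱ b) (t : Period T) {ω : Ω} (hω : P {ω} ≠ 0) :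
    impactState G g (fun t ω => a t ω + b t ω) t ω = impactState G g a t ω + volterra G b t ω := by
  have := volterra_sub hG (ha.add hb) ha t hω
  simp only [add_sub_cancel_left] at this
  simp only [impactState]
  linarith

/-- The trading cost is `integral_impact_cost_le`. The squared inventory increments enter with a
negative sign and are dropped; the cross terms become the `kernelH` terms and the `X₀` term of the
variation. -/
lemma payoff_le (hd : RegularData P ℱ h G g M L) {hT : 0 < T} {X₀ φ ϱ γ : ℝ} (hφ : 0 ≤ φ)
    (hϱ : 0 ≤ ϱ) (hS : IsL2 P ℱ S) {a b : Period T → Ω → ℝ} (ha : InBall P ℱ a)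
    (hb : IsL2 P ℱ b) {ω : Ω} (hω : P {ω} ≠ 0) :
    payoff hT X₀ φ ϱ γ h G g S (fun t ω => a t ω + b t ω) ω ≤
      payoff hT X₀ φ ϱ γ h G g S a ω + variation hT X₀ φ ϱ γ h G g S a b ω
        + (lossConst M L (kernelConst G).toReal ((leb T).real univ) - γ / 2)
          * pathInner b b ω := by
  have ma := ha.isL2.isSqInt.memLp_path hω
  have mb := hb.isSqInt.memLp_path hω
  have mS := hS.isSqInt.memLp_path hω
  have hab := ha.isL2.add hb
  have mz := ((hd.isL2_impactState ha.isL2).comp_lipschitz hd.lipschitz).isSqInt.memLp_path hω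
  have mzd := ((hd.isL2_impactState hab).comp_lipschitz hd.lipschitz).isSqInt.memLp_path hω
  have mq := (hd.isL2_weightedProc ha.isL2).isSqInt.memLp_path hω
  have md := (hb.volterra hd.kernel).isSqInt.memLp_path hω
  simp only [impactState_add hd.kernel ha.isL2 hb _ hω] at mzd
  have hd2 : ∀ t, volterra G b t ω ^ 2 ≤
      (kernelConst G).toReal * ∫ t, b t ω * b t ω ∂(leb T) := fun t => by
    have h1 := enorm_volterra_sq_le hd.kernel.meas (hb.isAdapted.path ω) t
    have hn : 0 ≤ pathInner b b ω := integral_nonneg fun t => mul_self_nonneg _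
    rw [enorm_sq_eq, hb.isSqInt.pathNormSq_eq hω, ← ENNReal.ofReal_toReal hd.kernel.const,
      ← ENNReal.ofReal_mul ENNReal.toReal_nonneg] at h1
    exact (ENNReal.ofReal_le_ofReal_iff (mul_nonneg ENNReal.toReal_nonneg hn)).1 h1
  have ha1 : ∫ t, a t ω * a t ω ∂(leb T) ≤ 1 := by
    have := ha.le_one ω hω
    rw [ha.isL2.isSqInt.pathNormSq_eq hω] at this
    exact ENNReal.ofReal_le_one.1 this
  have key := integral_impact_cost_le (γ := γ) ENNReal.toReal_nonneg
    (fun x y => hd.lipschitz.dist_le_mul x y) (abs_taylor_le hd.diff hd.lip) mS ma mb mz mzd mq md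
    hd2 ha1
  have mX := (ha.isL2.inventory X₀).isSqInt.memLp_path hω
  have mU := (ha.isL2.volterra isGoodKernel_one).isSqInt.memLp_path hω
  have mY := (hb.volterra isGoodKernel_one).isSqInt.memLp_path hω
  have ia := ma.integrable (by norm_num)
  have ib := mb.integrable (by norm_num)
  have hadd : ∀ t, inventory X₀ (fun t ω => a t ω + b t ω) t ω =
      inventory X₀ a t ω + volterra (fun _ _ => 1) b t ω := fun t => by
    simp only [inventory, volterra, one_mul]
    rw [integral_add ia.integrableOn ib.integrableOn, add_assoc]
  have hX : ∀ t, inventory X₀ a t ω = X₀ + volterra (fun _ _ => 1) a t ω := fun t =>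
    inventory_eq X₀ a t ω
  have hsq : ∫ t, inventory X₀ (fun t ω => a t ω + b t ω) t ω ^ 2 ∂(leb T) =
      ∫ t, inventory X₀ a t ω ^ 2 ∂(leb T)
      + 2 * (X₀ * ∫ t, volterra (fun _ _ => 1) b t ω ∂(leb T)
        + ∫ t, volterra (fun _ _ => 1) a t ω * volterra (fun _ _ => 1) b t ω ∂(leb T))
      + ∫ t, volterra (fun _ _ => 1) b t ω ^ 2 ∂(leb T) := by
    have iY := mY.integrable (q := 2) (by norm_num)
    have iUY : Integrable (fun t => volterra (fun _ _ => 1) a t ω * volterra (fun _ _ => 1) b t ω)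
      (leb T) := mU.integrable_mul mY
    have i1 : Integrable (fun t => X₀ * volterra (fun _ _ => 1) b t ω +
        volterra (fun _ _ => 1) a t ω * volterra (fun _ _ => 1) b t ω) (leb T) :=
      (iY.const_mul X₀).add iUY
    have i2 : Integrable (fun t => inventory X₀ a t ω ^ 2 +
        2 * (X₀ * volterra (fun _ _ => 1) b t ω +
        volterra (fun _ _ => 1) a t ω * volterra (fun _ _ => 1) b t ω)) (leb T) :=
      mX.integrable_sq.add (i1.const_mul 2)
    rw [← integral_const_mul, ← integral_add (iY.const_mul X₀) iUY, ← integral_const_mul,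
      ← integral_add mX.integrable_sq (i1.const_mul 2), ← integral_add i2 mY.integrable_sq]
    refine integral_congr_ae (Filter.Eventually.of_forall fun t => ?_)
    simp only [hadd, hX]
    ring
  have id1 := integral_weight_mul hT φ ϱ ib
  have id2 := inventory_identity hT φ ϱ ia ib
  have hST : pathInner (fun t ω => S (finalTime hT) ω - S t ω) b ω =
      S (finalTime hT) ω * volterra (fun _ _ => 1) b (finalTime hT) ω
        - ∫ t, S t ω * b t ω ∂(leb T) := by
    simp only [pathInner, volterra, one_mul, sub_mul]
    have iSb : Integrable (fun t => S t ω * b t ω) (leb T) := mS.integrable_mul mb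
    rw [integral_sub (ib.const_mul _) iSb, integral_const_mul,
      setIntegral_Iic_finalTime]
  have hpos1 : 0 ≤ φ / 2 * ∫ t, volterra (fun _ _ => 1) b t ω ^ 2 ∂(leb T) :=
    mul_nonneg (by positivity) (integral_nonneg fun t => sq_nonneg _)
  have hpos2 : 0 ≤ ϱ / 2 * volterra (fun _ _ => 1) b (finalTime hT) ω ^ 2 := by positivity
  have ev : ∀ (c : Period T → Ω → ℝ) t, ∫ s in Iic t, c s ω ∂(leb T) =
      volterra (fun _ _ => 1) c t ω := fun c t => by simp [volterra]
  simp only [ev] at id1 id2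
  change _ = pathInner (volterra (kernelH φ ϱ) a) b ω
    + pathInner a (volterra (kernelH φ ϱ) b) ω at id2
  have id3 := congrArg (X₀ * ·) id1
  have hexec : ∀ t, execPrice γ h G g S (fun t ω => a t ω + b t ω) t ω =
      S t ω + γ / 2 * (a t ω + b t ω) + h (impactState G g a t ω + volterra G b t ω) := fun t => by
    rw [execPrice, impactState_add hd.kernel ha.isL2 hb _ hω]
  simp only [payoff, variation, hST, hsq, hexec]
  rw [hadd, hX]
  simp only [execPrice, pathInner, weightedProc] at id2 id3 ⊢
  linarith

lemma integrable_variation (hd : RegularData P ℱ h G g M L) {hT : 0 < T} (X₀ φ ϱ γ : ℝ)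
    (hS : IsL2 P ℱ S) (hST : MemLp (S (finalTime hT)) 2 P) {a b : Period T → Ω → ℝ}
    (ha : IsL2 P ℱ a) (hb : IsL2 P ℱ b) :
    Integrable (variation hT X₀ φ ϱ γ h G g S a b) P ∧
    ∫ ω, variation hT X₀ φ ϱ γ h G g S a b ω ∂P =
      inner2 P (fun t ω => S (finalTime hT) ω - S t ω) b - γ * inner2 P a b
      - inner2 P (fun t ω => h (impactState G g a t ω)) b
      - inner2 P (weightedProc h G g a) (volterra G b)
      - inner2 P (volterra (kernelH φ ϱ) a) b
      - inner2 P a (volterra (kernelH φ ϱ) b)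
      - X₀ * inner2 P (fun t _ => φ * (T - t) + ϱ) b := by
  have hH := isGoodKernel_kernelH (T := T) φ ϱ
  exact integral_comb_seven γ X₀
    (((isSqInt_of_memLp hST).sub hS.isSqInt).integrable_pathInner hb.isSqInt)
    (ha.isSqInt.integrable_pathInner hb.isSqInt)
    (((hd.isL2_impactState ha).comp_lipschitz hd.lipschitz).isSqInt.integrable_pathInner hb.isSqInt)
    ((hd.isL2_weightedProc ha).isSqInt.integrable_pathInner (hb.volterra hd.kernel).isSqInt)
    ((ha.volterra hH).isSqInt.integrable_pathInner hb.isSqInt)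
    (ha.isSqInt.integrable_pathInner (hb.volterra hH).isSqInt)
    ((isL2_weight φ ϱ (ℱ := ℱ)).isSqInt.integrable_pathInner hb.isSqInt)

/-- Once the Volterra operators acting on `b` are moved to the other factor and `S_T - S` is
replaced by `α`, the integrand is `b` times the residual of the Fredholm equation at `a`. -/
lemma integral_variation_eq_zero (hd : RegularData P ℱ h G g M L) {hT : 0 < T} {X₀ φ ϱ γ : ℝ}
    (hγ : γ ≠ 0) (hS : IsL2 P ℱ S) (hST : MemLp (S (finalTime hT)) 2 P)
    (hα : IsAlphaSignal P ℱ hT S α) (hα2 : IsL2 P ℱ α) {a b : Period T → Ω → ℝ}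
    (ha : IsL2 P ℱ a) (hb : IsL2 P ℱ b)
    (hsol : ∀ ω, P {ω} ≠ 0 → ∀ᵐ t ∂(leb T), a t ω =
      fixMap P ℱ φ ϱ γ h G g (fun t ω => α t ω - X₀ * (φ * (T - t) + ϱ)) a t ω) :
    ∫ ω, variation hT X₀ φ ϱ γ h G g S a b ω ∂P = 0 := by
  have hH := isGoodKernel_kernelH (T := T) φ ϱ
  have hq := hd.isL2_weightedProc ha
  have hhz := (hd.isL2_impactState ha).comp_lipschitz hd.lipschitz
  rw [(integrable_variation hd X₀ φ ϱ γ hS hST ha hb).2, ← inner2_alpha hS hST hα hα2 hb,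
    inner2_volterra hd.kernel hq hb, inner2_volterra hH ha hb]
  have key := (integral_comb_seven γ X₀
    (hα2.isSqInt.integrable_pathInner hb.isSqInt)
    (ha.isSqInt.integrable_pathInner hb.isSqInt)
    (hhz.isSqInt.integrable_pathInner hb.isSqInt)
    ((hq.adjOp hd.kernel).isSqInt.integrable_pathInner hb.isSqInt)
    ((ha.volterra hH).isSqInt.integrable_pathInner hb.isSqInt)
    ((ha.adjOp hH).isSqInt.integrable_pathInner hb.isSqInt)
    ((isL2_weight φ ϱ (ℱ := ℱ)).isSqInt.integrable_pathInner hb.isSqInt)).2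
  refine Eq.trans key.symm (integral_eq_zero_of_ae (ae_iff_of_countable.2 fun ω hω => ?_))
  have mul : ∀ {u : Period T → Ω → ℝ}, IsL2 P ℱ u →
      Integrable (fun t => u t ω * b t ω) (leb T) := fun hu =>
    (hu.isSqInt.memLp_path hω).integrable_mul (hb.isSqInt.memLp_path hω)
  have key2 := (integral_comb_seven γ X₀ (mul hα2) (mul ha) (mul hhz) (mul (hq.adjOp hd.kernel))
    (mul (ha.volterra hH)) (mul (ha.adjOp hH)) (mul (isL2_weight φ ϱ))).2
  refine Eq.trans key2.symm (integral_eq_zero_of_ae ?_)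
  filter_upwards [hsol ω hω] with t ht
  rw [fixMap, fredOp, eq_inv_mul_iff_mul_eq₀ hγ] at ht
  simp only [Pi.zero_apply]
  linear_combination (-b t ω) * ht

/-- The quadratic estimate that makes a solution of the Fredholm equation optimal. -/
lemma performance_le (hd : RegularData P ℱ h G g M L) {hT : 0 < T} {X₀ φ ϱ γ : ℝ} (hφ : 0 ≤ φ)
    (hϱ : 0 ≤ ϱ) (hγ : γ ≠ 0) (hS : IsL2 P ℱ S) (hST : MemLp (S (finalTime hT)) 2 P)
    (hα : IsAlphaSignal P ℱ hT S α) (hα2 : IsL2 P ℱ α) {a u : Period T → Ω → ℝ}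
    (ha : InBall P ℱ a) (hu : IsL2 P ℱ u)
    (hsol : ∀ ω, P {ω} ≠ 0 → ∀ᵐ t ∂(leb T), a t ω =
      fixMap P ℱ φ ϱ γ h G g (fun t ω => α t ω - X₀ * (φ * (T - t) + ϱ)) a t ω) :
    performance P hT X₀ φ ϱ γ h G g S u ≤ performance P hT X₀ φ ϱ γ h G g S a
      + (lossConst M L (kernelConst G).toReal ((leb T).real univ) - γ / 2)
        * inner2 P (fun t ω => u t ω - a t ω) (fun t ω => u t ω - a t ω) := by
  set b : Period T → Ω → ℝ := fun t ω => u t ω - a t ω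
  have hb : IsL2 P ℱ b := hu.sub ha.isL2
  have hub : u = fun t ω => a t ω + b t ω := by
    funext t ω
    simp [b]
  have i0 := integrable_payoff hd X₀ φ ϱ γ hS hST hu
  have i1 := integrable_payoff hd X₀ φ ϱ γ hS hST ha.isL2
  have i2 := (integrable_variation hd X₀ φ ϱ γ hS hST ha.isL2 hb).1
  have i3 := (hb.isSqInt.integrable_pathInner hb.isSqInt).const_mul
    (lossConst M L (kernelConst G).toReal ((leb T).real univ) - γ / 2)
  have key : ∫ ω, payoff hT X₀ φ ϱ γ h G g S u ω ∂P ≤ _ :=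
    integral_mono_ae i0 ((i1.add i2).add i3) (ae_iff_of_countable.2 fun ω hω => by
      have := payoff_le (hT := hT) (X₀ := X₀) (γ := γ) hd hφ hϱ hS ha hb hω
      rw [← hub] at this
      exact this)
  have e1 := integral_add (i1.add i2) i3
  have e2 := integral_add i1 i2
  rw [integral_variation_eq_zero hd hγ hS hST hα hα2 ha.isL2 hb hsol, add_zero] at e2
  rw [integral_const_mul] at e1
  exact key.trans_eq (e1.trans (congrArg (· + _) e2))

lemma ae_eq_of_inner2_sub_nonpos {u v : Period T → Ω → ℝ} (hu : IsL2 P ℱ u) (hv : IsL2 P ℱ v)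
    (h0 : inner2 P (fun t ω => u t ω - v t ω) (fun t ω => u t ω - v t ω) ≤ 0) :
    ∀ ω, P {ω} ≠ 0 → ∀ᵐ t ∂(leb T), u t ω = v t ω := by
  have hw := (hu.sub hv).isSqInt
  have hnn : 0 ≤ pathInner (fun t ω => u t ω - v t ω) (fun t ω => u t ω - v t ω) :=
    fun ω => integral_nonneg fun t => mul_self_nonneg _
  have h1 := (integral_eq_zero_iff_of_nonneg hnn (hw.integrable_pathInner hw)).1
    (le_antisymm h0 (integral_nonneg hnn))
  refine ae_eq_of_normSq_sub_eq_zero hu.isAdapted hv.isAdapted ?_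
  rw [normSq, lintegral_eq_zero_iff (measurable_pathNormSq_of_discrete _)]
  refine ae_iff_of_countable.2 fun ω hω => ?_
  rw [hw.pathNormSq_eq hω, ae_iff_of_countable.1 h1 ω hω]
  simp

/-- The right-hand side of the fixed point equation is pathwise bounded. -/
lemma exists_bound_source (hd : RegularData P ℱ h G g M L) (X₀ φ ϱ : ℝ) (hα : IsLinfL2 P ℱ α)
    (hg : IsLinfL2 P ℱ g) : ∃ K : ℝ≥0∞, K ≠ ∞ ∧ ∀ ω, P {ω} ≠ 0 →
      pathNormSq (fun t ω => α t ω - X₀ * (φ * (T - t) + ϱ) - h (g t ω)) ω ≤ K := by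
  obtain ⟨c₁, hc₁, h₁⟩ := hα.exists_bound
  obtain ⟨c₂, hc₂, h₂⟩ := hg.exists_bound
  have hκ : IsL2 P ℱ fun (t : Period T) (_ : Ω) => X₀ * (φ * (T - t) + ϱ) + h 0 :=
    ((isL2_weight φ ϱ).const_mul X₀).add (.const _)
  have h₃ : ∀ ω, pathNormSq (fun (t : Period T) (_ : Ω) => X₀ * (φ * (T - t) + ϱ) + h 0) ω =
      normSq P (fun (t : Period T) (_ : Ω) => X₀ * (φ * (T - t) + ϱ) + h 0) := fun ω => by
    simp only [normSq, pathNormSq, lintegral_const, measure_univ, mul_one]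
  refine ⟨2 * (2 * (c₁ + normSq P (fun (t : Period T) (_ : Ω) => X₀ * (φ * (T - t) + ϱ) + h 0))
    + M ^ 2 * c₂), ?_, fun ω hω => ?_⟩
  · have := hκ.isSqInt.finite
    finiteness
  -- Subtracting `h 0` makes the last term at most `M |g|`; the constant joins the deterministic
  -- part.
  have e : (fun t ω => α t ω - X₀ * (φ * (T - t) + ϱ) - h (g t ω)) =
      fun t ω => (α t ω - (X₀ * (φ * (T - t) + ϱ) + h 0)) - (h (g t ω) - h 0) := by
    funext t ω
    ring
  rw [e]
  refine (pathNormSq_sub_le (u := fun t ω => α t ω - (X₀ * (φ * (T - t) + ϱ) + h 0))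
    (v := fun t ω => h (g t ω) - h 0) ((hα.isL2.sub hκ).isAdapted.path ω)).trans ?_
  refine mul_le_mul_right (add_le_add ((pathNormSq_sub_le (v := fun t _ =>
    X₀ * (φ * (T - t) + ϱ) + h 0) (hα.isL2.isAdapted.path ω)).trans ?_) ?_) 2
  · rw [h₃]
    gcongr
    exact h₁ ω hω
  · refine le_trans ?_ (mul_le_mul_right (h₂ ω hω) _)
    rw [pathNormSq, pathNormSq, ← lintegral_const_mul' _ _ (by simp)]
    refine lintegral_mono fun t => ?_
    rw [← mul_pow]
    have := hd.enorm_sub_le (g t ω) 0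
    rw [sub_zero] at this
    gcongr

end Optimality

end OptimalTrading

end

/-! ### Choice of the threshold and conclusion. -/

open OptimalTrading in
theorem theorem2p3
    {Ω : Type*} [Countable Ω] [MeasurableSpace Ω] [DiscreteMeasurableSpace Ω]
    (P : Measure Ω) [IsProbabilityMeasure P]
    {T : ℝ} (hT : 0 < T)
    (ℱ : Filtration (Period T) ‹MeasurableSpace Ω›) (hℱ : UsualConditions P ℱ)
    (X₀ φ ϱ : ℝ) (hX₀ : 0 < X₀) (hφ : 0 ≤ φ) (hϱ : 0 ≤ ϱ)
    (S : Period T → Ω → ℝ) (hS : IsL2 P ℱ S) (hST : MemLp (S (finalTime hT)) 2 P)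
    (α : Period T → Ω → ℝ) (hα : IsAlphaSignal P ℱ hT S α) (hα_inf : IsLinfL2 P ℱ α)
    (g : Period T → Ω → ℝ) (hg_inf : IsLinfL2 P ℱ g)
    (h : ℝ → ℝ) (hh_sublinear : StrictlySublinear h) (hh_diff : Differentiable ℝ h)
    (hh_bdd : ∃ C : ℝ, ∀ x, |deriv h x| ≤ C) (hh_lip : ∃ L : ℝ≥0, LipschitzWith L (deriv h))
    (G : Period T → Period T → ℝ) (hG : AdmissibleKernel G) (hG_psd : PosSemidefKernel P ℱ G)
    (hG_adj : adjKernelConst G < ∞) :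
    ∃ γ₀ : ℝ, 0 < γ₀ ∧ ∀ γ : ℝ, γ₀ ≤ γ →
      ∃ û : Period T → Ω → ℝ,
        IsOptimal P ℱ hT X₀ φ ϱ γ h G g S û ∧
        (∀ v : Period T → Ω → ℝ, IsOptimal P ℱ hT X₀ φ ϱ γ h G g S v → AEEq P v û) ∧
        IsLinfL2 P ℱ û ∧
        SolvesFredholm P ℱ X₀ φ ϱ γ h G g α û ∧
        (∀ v : Period T → Ω → ℝ, IsL2 P ℱ v →
          SolvesFredholm P ℱ X₀ φ ϱ γ h G g α v → AEEq P v û) := by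
  obtain ⟨C, hC⟩ := hh_bdd
  obtain ⟨L, hL⟩ := hh_lip
  have hd : RegularData P ℱ h G g C.toNNReal L :=
    { diff := hh_diff
      bound := fun x => by
        rw [← NNReal.coe_le_coe, coe_nnnorm, Real.coe_toNNReal']
        exact (hC x).trans (le_max_left _ _)
      lip := hL
      kernel := ⟨hG.1, hG.2.ne, hG_adj.ne⟩
      state := hg_inf.isL2 }
  set M := C.toNNReal
  have hα2 : IsL2 P ℱ α := hα_inf.isL2
  have hκ : IsL2 P ℱ fun (t : Period T) (_ : Ω) => X₀ * (φ * (T - t) + ϱ) :=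
    (isL2_weight φ ϱ).const_mul X₀
  set F : Period T → Ω → ℝ := fun t ω => α t ω - X₀ * (φ * (T - t) + ϱ)
  have hF : IsL2 P ℱ F := hα2.sub hκ
  obtain ⟨K, hK, hFK⟩ : ∃ K : ℝ≥0∞, K ≠ ∞ ∧
      ∀ ω, P {ω} ≠ 0 → pathNormSq (fun t ω => F t ω - h (g t ω)) ω ≤ K :=
    exists_bound_source hd X₀ φ ϱ hα_inf hg_inf
  obtain ⟨γ₁, hγ₁, hγ₁'⟩ :=
    exists_gamma (contractConst_ne_top (M := M) (L := L) φ ϱ hd.kernel hK)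
  -- The first entry makes the fixed point map a contraction of the ball; the second, with its `+
  -- 1`, makes the quadratic coefficient strictly negative.
  refine ⟨max γ₁ (2 * lossConst M L (kernelConst G).toReal ((leb T).real univ) + 1),
    lt_max_of_lt_left hγ₁, fun γ hγ => ?_⟩
  have hγc := hγ₁' γ ((le_max_left _ _).trans hγ)
  have hγ0 : γ ≠ 0 := (hγ₁.trans_le ((le_max_left _ _).trans hγ)).ne'
  have hloss : lossConst M L (kernelConst G).toReal ((leb T).real univ) - γ / 2 < 0 := by
    linarith [(le_max_right _ _).trans hγ]
  obtain ⟨û, hû, hfix⟩ := exists_fixedPoint (P := P) (ℱ := ℱ)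
    (Φ := fixMap P ℱ φ ϱ γ h G g F)
    (fun u hu => hd.inBall_fixMap φ ϱ hγc hF hFK hu)
    (fun u v hu hv => hd.normSq_fixMap_sub_le φ ϱ hγc hu.isL2 hv)
  have hperf := fun {u : Period T → Ω → ℝ} (hu : IsL2 P ℱ u) =>
    performance_le (X₀ := X₀) hd hφ hϱ hγ0 hS hST hα hα2 hû hu hfix
  refine ⟨û, ⟨hû.isL2, fun u hu => (hperf hu).trans ?_⟩, fun v hv => ?_, hû.isLinfL2,
    (solvesFredholm_iff hd hγ0 hû.isL2).2 hfix, fun v hv hsol => ?_⟩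
  · have : 0 ≤ inner2 P (fun t ω => u t ω - û t ω) (fun t ω => u t ω - û t ω) :=
      integral_nonneg fun ω => integral_nonneg fun t => mul_self_nonneg _
    nlinarith
  -- Another optimiser attains the same value, so the strictly negative quadratic term forces its
  -- distance to `û` to be zero.
  · refine ae_prod_iff_of_countable.2 (ae_eq_of_inner2_sub_nonpos hv.1 hû.isL2 ?_)
    have h1 := (hv.2 û hû.isL2).trans (hperf hv.1)
    by_contra! hpos
    nlinarith
  · exact ae_prod_iff_of_countable.2 (ae_eq_of_fixedPoints hv hû.isL2
      (hd.normSq_fixMap_sub_le φ ϱ hγc hv hû) ((solvesFredholm_iff hd hγ0 hv).1 hsol) hfix)
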